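/- Let $k,d\ge 0$ be integers and let $p$ be a probability density on $\mathbb R^d$ (with respect to Lebesgue measure) with $\int \|x\|^2p(x)\,dx<\infty$. For a weight vector $\theta=(\theta_{\rm OUT},\theta_{\rm LDR})\in\mathbb R^{k+1}\times\mathbb R^{k(d+1)}$, with $\theta_{\rm OUT}=(a_0,a_1,\dots,a_k)$ and $\theta_{\rm LDR}=(w_i,b_i)_{1\le i\le k}$, $w_i\in\mathbb R^d$, $b_i\in\mathbb R$, consider the single-hidden-layer network with linear output $$f_\theta(x)=a_0+\sum_{i=1}^k a_i\tanh(w_i\cdot x+b_i).$$ Call $\theta$ irreducible if $a_i\ne0$ and $w_i\neq 0$ for all $i$ and $(w_i,b_i)\ne\pm(w_j,b_j)$ for all $i\ne j$, and admissible if there is $\delta>0$ with $\delta\le f_\theta(x)\le 1-\delta$ for almost every $x$ with $p(x)>0$. For such $\theta$ let $P_\theta$ be the distribution of $(x,y)\in\mathbb R^d\times\{0,1\}$ with density $p(x)f_\theta(x)$ at $y=1$ and $p(x)(1-f_\theta(x))$ at $y=0$. Let $X$ be the set of irreducible admissible $\theta$ modulo permutations of the hidden nodes and simultaneous sign changes $(a_i,w_i,b_i)\mapsto(-a_i,-w_i,-b_i)$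 at hidden nodes. The distribution $P_\theta$ depends only on the class of $\theta$. Let $$\Delta_H(\theta,\theta')=\sum_{y\in\{0,1\}}\int_{\mathbb R^d}\Bigl[\sqrt{p(x,y|\theta)}-\sqrt{p(x,y|\theta')}\Bigr]^2dx$$ be the squared Hellinger distance, where $p(x,y|\theta)$ denotes the above density of $P_\theta$, and let $\|\theta-\theta'\|$ on $X$ denote the least Euclidean distance between representatives of the two classes. Theorem. $\Delta_H^{1/2}$ and $\|\theta-\theta'\|$ are metrics on $X$, and $\Delta_H^{1/2}(\theta,\theta')$ is locally dominated by $\|\theta-\theta'\|$ on $X$: for every $\theta\in X$ there are $\varepsilon,c,c'>0$ such that for all $\theta'\in X$ with $\Delta_H^{1/2}(\theta,\theta')\le\varepsilon$, $$c\,\|\theta-\theta'\|\le\Delta_H^{1/2}(\theta,\theta')\le c'\,\|\theta-\theta'\|.$$ -/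

import Mathlib

open MeasureTheory

noncomputable section

namespace LDR

/-! ## Two metrics on one set -/

/-- `ρ` is a metric on `X`. -/
structure IsMetric {X : Type*} (ρ : X → X → ℝ) : Prop where
  nonneg : ∀ x y, 0 ≤ ρ x y
  eq_zero_iff : ∀ x y, ρ x y = 0 ↔ x = y
  symm : ∀ x y, ρ x y = ρ y x
  triangle : ∀ x y z, ρ x z ≤ ρ x y + ρ y z

/-- `ρ` is locally dominated by `ρ'`: around every point `x` the two are comparable, with
constants depending on `x`, on a small `ρ`-ball around `x`. -/
def LocallyDominatedBy {X : Type*} (ρ ρ' : X → X → ℝ) : Prop :=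
  ∀ x : X, ∃ ε > 0, ∃ c > 0, ∃ c' > 0, ∀ x' : X, ρ x x' ≤ ε →
    c * ρ' x x' ≤ ρ x x' ∧ ρ x x' ≤ c' * ρ' x x'

/-! ## Networks with `k` sigmoidal hidden nodes, `d` inputs and one linear output node -/

/-- Weights of the output node: `none` is its bias, `some i` its weight from hidden node `i`. -/
abbrev OutIndex (k : ℕ) : Type := Option (Fin k)

/-- Hidden-layer weights: `(i, none)` is the bias of hidden node `i` and `(i, some j)` its
weight from input `j`. -/
abbrev LdrIndex (k d : ℕ) : Type := Fin k × Option (Fin d)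

/-- Weight vectors `θ = (θ_OUT, θ_LDR)` with the Euclidean norm. -/
abbrev Weights (k d : ℕ) : Type := EuclideanSpace ℝ (OutIndex k ⊕ LdrIndex k d)

/-- Input space. -/
abbrev Input (d : ℕ) : Type := EuclideanSpace ℝ (Fin d)

variable {k d : ℕ}

/-- The affine form fed into hidden node `i`. -/
def preactivation (θ : Weights k d) (i : Fin k) (x : Input d) : ℝ :=
  ∑ j, θ (.inr (i, some j)) * x j + θ (.inr (i, none))

/-- The network function `f_θ`. -/
def output (θ : Weights k d) (x : Input d) : ℝ :=
  ∑ i, θ (.inl (some i)) * Real.tanh (preactivation θ i x) + θ (.inl none)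

/-- Permute the hidden nodes by `σ` and change the sign of all incoming and outgoing weights
of the nodes `i` with `s i = -1`. -/
def relabel (σ : Equiv.Perm (Fin k)) (s : Fin k → ℤˣ) (θ : Weights k d) : Weights k d :=
  WithLp.toLp 2 fun
    | .inl none => θ (.inl none)
    | .inl (some i) => ((s i : ℤ) : ℝ) * θ (.inl (some (σ i)))
    | .inr (i, j) => ((s i : ℤ) : ℝ) * θ (.inr (σ i, j))

/-- Irreducible networks: every hidden node is connected to the output, no hidden node is
constant, and no two hidden nodes compute the same function up to sign. -/
structure IsIrreducible (θ : Weights k d) : Prop where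
  outgoing_ne_zero : ∀ i, θ (.inl (some i)) ≠ 0
  incoming_ne_zero : ∀ i, ∃ j, θ (.inr (i, some j)) ≠ 0
  ne_of_ne : ∀ i i', i ≠ i' → ∃ j, θ (.inr (i, j)) ≠ θ (.inr (i', j))
  ne_neg_of_ne : ∀ i i', i ≠ i' → ∃ j, θ (.inr (i, j)) ≠ -θ (.inr (i', j))

/-! ## The statistical model `p(x, y = 1 | θ) = p(x) f_θ(x)` -/

/-- Probability densities on the input space with finite second moments. -/
structure IsInputDensity (p : Input d → ℝ) : Prop where
  measurable : Measurable p
  nonneg : ∀ x, 0 ≤ p x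
  integral_eq_one : ∫ x, p x = 1
  secondMoment : Integrable (fun x => ‖x‖ ^ 2 * p x)

/-- On (almost all) possible inputs, the output of the network is a class probability that
stays away from `0` and `1`. -/
def IsAdmissible (p : Input d → ℝ) (θ : Weights k d) : Prop :=
  ∃ δ > 0, ∀ᵐ x : Input d, 0 < p x → δ ≤ output θ x ∧ output θ x ≤ 1 - δ

/-- The networks of the model. -/
def Network (p : Input d → ℝ) (k : ℕ) : Type :=
  {θ : Weights k d // IsIrreducible θ ∧ IsAdmissible p θ}

/-- The dominating measure on input-label pairs. -/
def baseMeasure (d : ℕ) : Measure (Input d × Bool) := (volume : Measure (Input d)).prod Measure.count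

/-- The density `p(z | θ)`, for `z = (x, y)`. -/
def density (p : Input d → ℝ) (θ : Weights k d) (z : Input d × Bool) : ℝ :=
  if z.2 then p z.1 * output θ z.1 else p z.1 * (1 - output θ z.1)

/-! ## The factor space -/

lemma sign_mul_self (u : ℤˣ) : ((u : ℤ) : ℝ) * ((u : ℤ) : ℝ) = 1 := by
  rcases Int.units_eq_one_or u with h | h <;> simp [h]

lemma preactivation_relabel (σ : Equiv.Perm (Fin k)) (s : Fin k → ℤˣ) (θ : Weights k d)
    (i : Fin k) (x : Input d) :
    preactivation (relabel σ s θ) i x = ((s i : ℤ) : ℝ) * preactivation θ (σ i) x := by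
  simp [preactivation, relabel, mul_add, Finset.mul_sum, mul_assoc]

lemma output_relabel (σ : Equiv.Perm (Fin k)) (s : Fin k → ℤˣ) (θ : Weights k d) :
    output (relabel σ s θ) = output θ := by
  funext x
  simp only [output, preactivation_relabel]
  congr 1
  rw [← Equiv.sum_comp σ (fun i => θ (.inl (some i)) * Real.tanh (preactivation θ i x))]
  refine Finset.sum_congr rfl fun i _ => ?_
  simp only [relabel]
  rcases Int.units_eq_one_or (s i) with h | h <;> simp [h]

/-- Two networks are identified when they differ by a permutation of the hidden nodes and
sign changes at hidden nodes. -/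
def networkSetoid (p : Input d → ℝ) (k : ℕ) : Setoid (Network p k) where
  r θ θ' := ∃ (σ : Equiv.Perm (Fin k)) (s : Fin k → ℤˣ), θ'.1 = relabel σ s θ.1
  iseqv :=
    { refl := fun θ => ⟨1, 1, by
        ext a; rcases a with (_ | i) | ⟨i, j⟩ <;> simp [relabel]⟩
      symm := by
        rintro θ θ' ⟨σ, s, h⟩
        refine ⟨σ⁻¹, fun i => s (σ⁻¹ i), ?_⟩
        ext a
        rcases a with (_ | i) | ⟨i, j⟩ <;>
          simp [h, relabel, ← mul_assoc, sign_mul_self]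
      trans := by
        rintro θ θ' θ'' ⟨σ, s, h⟩ ⟨σ', s', h'⟩
        refine ⟨σ * σ', fun i => s' i * s (σ' i), ?_⟩
        ext a
        rcases a with (_ | i) | ⟨i, j⟩ <;> simp [h, h', relabel, mul_assoc] }

/-- The space of networks modulo hidden-node permutations and sign changes. -/
def FactorSpace (p : Input d → ℝ) (k : ℕ) : Type := Quotient (networkSetoid p k)

/-- The class of a network. -/
def toFactor {p : Input d → ℝ} (θ : Network p k) : FactorSpace p k :=
  Quotient.mk (networkSetoid p k) θ

/-- The density `p(z | θ)` depends only on the class of `θ`. -/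
def factorDensity {p : Input d → ℝ} (q : FactorSpace p k) : Input d × Bool → ℝ :=
  Quotient.lift (s := networkSetoid p k) (fun θ : Network p k => density p θ.1)
    (by
      rintro θ θ' ⟨σ, s, h⟩
      funext z
      simp only [density, h, output_relabel]) q

/-- The squared Hellinger distance `Δ_H`. -/
def hellingerSq {p : Input d → ℝ} (q q' : FactorSpace p k) : ℝ :=
  ∫ z, (√(factorDensity q z) - √(factorDensity q' z)) ^ 2 ∂(baseMeasure d)

/-- `Δ_H^{1/2}`. -/
def hellingerDist {p : Input d → ℝ} (q q' : FactorSpace p k) : ℝ := √(hellingerSq q q')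

/-- `‖θ - θ'‖` on the factor space: the least Euclidean distance between representatives. -/
def weightDist {p : Input d → ℝ} (q q' : FactorSpace p k) : ℝ :=
  sInf {r : ℝ | ∃ θ θ' : Network p k, toFactor θ = q ∧ toFactor θ' = q' ∧ r = ‖θ.1 - θ'.1‖}

end LDR

end

open Filter Topology

namespace LDR

/-! ## Real sequences along an ultrafilter -/

section Ultrafilter

variable {N : Type*}

/-! The relabellings form a finite group of isometries of weight space, so the least distance
between two classes is attained with one representative held fixed; this makes `weightDist` a
metric. The Hellinger distance is the `L²` distance of the square roots of the densities. It
vanishes only if the two outputs agree on a set of positive measure, and then the networks are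
relabellings of each other (`eq_relabel_of_output_eq`).

The upper bound is a Lipschitz estimate: the output changes by at most a multiple of `(1 + ‖x‖) * ‖θ
- θ'‖`, the square root is smooth because `f_θ` stays away from `0` and `1`, and the second moment
of `p` makes the estimate integrable (`exists_hellingerSq_le`).

The lower bound is by contradiction (`not_hellinger_faster`). A sequence violating it has, after
passing to a subsequence, outputs converging to that of `θ` pointwise on a set of positive measure,
faster than the weight distance. If its weights converge along an ultrafilter, the limit is a
relabelling of `θ`. A limit of the normalized weight differences is then a unit vector in whose
direction the derivative of the output vanishes on that set, which contradicts the linear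
independence in `tanh_independent`.

The main difficulty is convergence of the weights (`exists_tendsto_of_output_tendsto`), since no
bound on them is given. On suitable lines the problem has one variable. Subtract the limit network,
and split the nodes into those whose parameters converge and those that diverge; after shrinking the
set and changing signs the latter saturate. Multiplying by all factors `1 + exp (2 u)` turns the
output into an exponential sum, with coefficients that may be unbounded. Smallness on a set of
positive measure passes to the part with bounded frequencies (`bounded_part_tendsto_zero`), and
there it is uniform on compact subsets of the complex plane. Dividing back and integrating over a
small circle shows that the residues `a / w` of the convergent nodes cancel at every point
(`tendsto_residue_sum_zero`). Every node of the limit has a nonzero residue, so some node of the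
sequence must converge to it; as the numbers of nodes are equal, this is a bijection
(`exists_matching`). -/

lemma tendsto_of_bounded (𝒰 : Ultrafilter N) {X : Type*} [PseudoMetricSpace X] [ProperSpace X]
    {x : N → X} {a : X} {C : ℝ} (h : ∀ᶠ n in (𝒰 : Filter N), dist (x n) a ≤ C) :
    ∃ l, Tendsto x 𝒰 (𝓝 l) := by
  obtain ⟨l, -, hl⟩ := (isCompact_closedBall a C).ultrafilter_le_nhds (𝒰.map x) (by
    rw [le_principal_iff]; exact h)
  exact ⟨l, hl⟩

lemma tendsto_trichotomy (𝒰 : Ultrafilter N) (x : N → ℝ) :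
    (∃ l, Tendsto x 𝒰 (𝓝 l)) ∨ Tendsto x 𝒰 atTop ∨ Tendsto x 𝒰 atBot := by
  by_cases h1 : Tendsto x 𝒰 atTop
  · exact Or.inr (Or.inl h1)
  by_cases h2 : Tendsto x 𝒰 atBot
  · exact Or.inr (Or.inr h2)
  rw [tendsto_atTop] at h1
  rw [tendsto_atBot] at h2
  push Not at h1 h2
  obtain ⟨B, hB⟩ := h1
  obtain ⟨A, hA⟩ := h2
  refine Or.inl (tendsto_of_bounded 𝒰 (a := 0) (C := max |A| |B|) ?_)
  filter_upwards [hA, hB] with n hn hn'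
  rw [Real.dist_eq, sub_zero, abs_le]
  constructor
  · linarith [neg_abs_le A, le_max_left |A| |B|]
  · linarith [le_abs_self B, le_max_right |A| |B|]

end Ultrafilter

/-! ## Translates of sets of positive measure -/

/-- Otherwise Fubini gives, for almost every `t ∈ E`, that the set of `τ` with `t + τ ∈ E` is null;
but this set is a translate of `E`. The lemma allows differencing of functions known only on `E`. -/
lemma exists_pos_inter_translate {E : Set ℝ} (hE : MeasurableSet E) (h0 : volume E ≠ 0) :
    ∃ τ > 0, volume (E ∩ (fun t => t + τ) ⁻¹' E) ≠ 0 := by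
  by_contra! hcon
  have key : ∀ τ : ℝ, τ ≠ 0 → volume (E ∩ (fun t => t + τ) ⁻¹' E) = 0 := by
    intro τ hτ
    rcases lt_or_gt_of_ne hτ with h | h
    · have h1 := hcon (-τ) (by linarith)
      have h2 : (fun t => t + -τ) ⁻¹' (E ∩ (fun t => t + τ) ⁻¹' E) =
          E ∩ (fun t => t + -τ) ⁻¹' E := by
        ext t; simp [and_comm]
      rw [← h2, measure_preimage_add_right] at h1
      exact h1
    · exact hcon τ h
  have hmeas : MeasurableSet {q : ℝ × ℝ | q.2 ∈ E ∧ q.2 + q.1 ∈ E} :=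
    (measurable_snd hE).inter ((measurable_snd.add measurable_fst) hE)
  have h1 : ∀ᵐ τ : ℝ, ∀ᵐ t : ℝ, ¬ (t ∈ E ∧ t + τ ∈ E) := by
    have : ∀ᵐ τ : ℝ, τ ≠ 0 := by
      rw [ae_iff]; simp
    filter_upwards [this] with τ hτ
    rw [ae_iff]
    simpa [Set.inter_def] using key τ hτ
  rw [Measure.ae_ae_comm hmeas.compl] at h1
  apply h0
  have h2 : ∀ᵐ t : ℝ, t ∉ E := by
    filter_upwards [h1] with t ht hmem
    apply h0
    have : volume ((fun τ => t + τ) ⁻¹' E) = 0 := by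
      rw [ae_iff] at ht
      refine measure_mono_null ?_ ht
      intro τ hτ
      simp only [Set.mem_preimage] at hτ
      simp [hmem, hτ]
    rwa [measure_preimage_add] at this
  simpa [ae_iff] using h2

lemma exists_frequently_mem {E : Set ℝ} (h0 : volume E ≠ 0) :
    ∃ t₀, ∃ᶠ t in 𝓝[≠] t₀, t ∈ E := by
  obtain ⟨x, hx, h⟩ := exists_mem_forall_mem_nhdsWithin_pos_measure h0
  refine ⟨x, fun hcon => ?_⟩
  -- Every neighbourhood of `x` within `E` has positive measure, so `x` cannot be isolated in `E`.
  have : {x} ∈ 𝓝[E] x := by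
    rw [mem_nhdsWithin_iff_eventually]
    rw [eventually_nhdsWithin_iff] at hcon
    filter_upwards [hcon] with t ht htE
    by_contra hne
    exact ht hne htE
  simpa using h _ this

lemma eq_zero_of_forall_mem_eq_zero {F : ℂ → ℂ} (hF : Differentiable ℂ F) {E : Set ℝ}
    (h0 : volume E ≠ 0) (h : ∀ t ∈ E, F t = 0) : ∀ z, F z = 0 := by
  obtain ⟨t₀, ht₀⟩ := exists_frequently_mem h0
  have hfr : ∃ᶠ z in 𝓝[≠] (t₀ : ℂ), F z = 0 := by
    have hmap : Tendsto (fun t : ℝ => (t : ℂ)) (𝓝[≠] t₀) (𝓝[≠] (t₀ : ℂ)) := by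
      refine tendsto_nhdsWithin_of_tendsto_nhds_of_eventually_within _
        (Complex.continuous_ofReal.continuousAt.tendsto.mono_left nhdsWithin_le_nhds) ?_
      filter_upwards [self_mem_nhdsWithin] with t ht
      simpa using ht
    exact hmap.frequently (ht₀.mono fun t ht => h t ht)
  have := (hF.differentiableOn.analyticOnNhd isOpen_univ).eqOn_zero_of_preconnected_of_frequently_eq_zero
    isPreconnected_univ (Set.mem_univ _) hfr
  exact fun z => this (Set.mem_univ z)

/-! ## Exponential sums and their moments -/

section Moments

variable {σ : Type*}

/-- The moments satisfy a linear recurrence of order `S.card`, so the first `S.card` of them control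
the rest. No Vandermonde matrix is inverted: the bound is uniform even when frequencies coalesce and
the coefficients blow up. -/
lemma moment_bound [DecidableEq σ] {L : ℝ} (hL : 1 ≤ L) (l : σ → ℝ) (S : Finset σ) :
    ∀ (c : σ → ℂ) (A : ℝ), 0 ≤ A → (∀ i ∈ S, |l i| ≤ L) →
      (∀ m < S.card, ‖∑ i ∈ S, c i * (l i : ℂ) ^ m‖ ≤ A) →
      ∀ m, ‖∑ i ∈ S, c i * (l i : ℂ) ^ m‖ ≤ A * (3 * L) ^ m := by
  induction S using Finset.induction_on with
  | empty =>
    intro c A hA _ _ m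
    simp only [Finset.sum_empty, norm_zero]
    positivity
  | insert i₀ S hi ih =>
    intro c A hA hl hc m
    set h : ℕ → ℂ := fun m => ∑ i ∈ insert i₀ S, c i * (l i : ℂ) ^ m with hh
    -- One step of the recurrence removes the frequency `l i₀`, leaving a moment sequence with one
    -- term fewer.
    have hk : ∀ m, h (m + 1) - l i₀ * h m = ∑ i ∈ S, (c i * (l i - l i₀)) * (l i : ℂ) ^ m := by
      intro m
      simp only [hh, Finset.mul_sum, ← Finset.sum_sub_distrib]
      rw [Finset.sum_insert hi]
      rw [show c i₀ * (l i₀ : ℂ) ^ (m + 1) - l i₀ * (c i₀ * (l i₀ : ℂ) ^ m) = 0 by ring, zero_add]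
      exact Finset.sum_congr rfl fun i _ => by ring
    have hl0 : ‖(l i₀ : ℂ)‖ ≤ L := by
      rw [Complex.norm_real]; exact hl i₀ (Finset.mem_insert_self _ _)
    rw [Finset.card_insert_of_notMem hi] at hc
    have hkb := ih (fun i => c i * (l i - l i₀)) (2 * L * A) (by positivity)
      (fun i hi => hl i (Finset.mem_insert_of_mem hi)) (by
        intro m hm
        rw [← hk]
        have h1 := hc (m + 1) (by omega)
        have h2 := hc m (by omega)
        calc ‖h (m + 1) - l i₀ * h m‖ ≤ ‖h (m + 1)‖ + ‖(l i₀ : ℂ)‖ * ‖h m‖ := by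
              rw [← norm_mul]; exact norm_sub_le _ _
          _ ≤ A + L * A := by gcongr
          _ ≤ 2 * L * A := by nlinarith)
    change ‖h m‖ ≤ _
    induction m with
    | zero => simpa [hh] using hc 0 (by omega)
    | succ m ihm =>
      have h1 := hkb m
      rw [← hk] at h1
      calc ‖h (m + 1)‖ = ‖(h (m + 1) - l i₀ * h m) + l i₀ * h m‖ := by ring_nf
        _ ≤ ‖h (m + 1) - l i₀ * h m‖ + ‖(l i₀ : ℂ)‖ * ‖h m‖ := by
            rw [← norm_mul]; exact norm_add_le _ _
        _ ≤ 2 * L * A * (3 * L) ^ m + L * (A * (3 * L) ^ m) := by gcongr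
        _ = A * (3 * L) ^ (m + 1) := by ring

lemma hasSum_expSum (S : Finset σ) (c : σ → ℂ) (l : σ → ℝ) (m : ℕ) (z : ℂ) :
    HasSum (fun r : ℕ => (∑ i ∈ S, c i * (l i : ℂ) ^ (m + r)) * (z ^ r / r.factorial))
      (∑ i ∈ S, c i * (l i : ℂ) ^ m * Complex.exp (l i * z)) := by
  have : ∀ i ∈ S, HasSum (fun r : ℕ => c i * (l i : ℂ) ^ m * ((l i * z) ^ r / r.factorial))
      (c i * (l i : ℂ) ^ m * Complex.exp (l i * z)) := by
    intro i _
    apply HasSum.mul_left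
    rw [Complex.exp_eq_exp_ℂ]
    exact NormedSpace.expSeries_div_hasSum_exp (l i * z : ℂ)
  convert hasSum_sum this using 2 with r
  rw [Finset.sum_mul]
  exact Finset.sum_congr rfl fun i _ => by ring

/-- The Taylor coefficients of an exponential sum are its moments, so moment bounds become bounds on
compact sets, whatever the size of the individual coefficients. -/
lemma norm_expSum_le {S : Finset σ} {c : σ → ℂ} {l : σ → ℝ} {A C : ℝ}
    (h : ∀ m, ‖∑ i ∈ S, c i * (l i : ℂ) ^ m‖ ≤ A * C ^ m) (m : ℕ) (z : ℂ) :
    ‖∑ i ∈ S, c i * (l i : ℂ) ^ m * Complex.exp (l i * z)‖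
      ≤ A * C ^ m * Real.exp (C * ‖z‖) := by
  have h1 := hasSum_expSum S c l m z
  have h2 : HasSum (fun r : ℕ => A * C ^ m * ((C * ‖z‖) ^ r / r.factorial))
      (A * C ^ m * Real.exp (C * ‖z‖)) := by
    apply HasSum.mul_left
    rw [Real.exp_eq_exp_ℝ]
    exact NormedSpace.expSeries_div_hasSum_exp (C * ‖z‖)
  refine h1.norm_le_of_bounded h2 fun r => ?_
  rw [norm_mul, norm_div, norm_pow, Complex.norm_natCast]
  calc _ ≤ A * C ^ (m + r) * (‖z‖ ^ r / r.factorial) := by gcongr; exact h _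
    _ = _ := by ring

/-- The growth bound makes the series entire, and a set of positive measure has an accumulation
point. -/
lemma coeff_eq_zero {ℓ : ℕ → ℂ} {C : ℝ} (hℓ : ∀ m, ‖ℓ m‖ ≤ C ^ m) {E : Set ℝ}
    (h0 : volume E ≠ 0) (h : ∀ t ∈ E, ∑' m, ℓ m * ((t : ℂ) ^ m / m.factorial) = 0) (m : ℕ) :
    ℓ m = 0 := by
  set p : FormalMultilinearSeries ℂ ℂ ℂ :=
    FormalMultilinearSeries.ofScalars ℂ (fun m => ℓ m / m.factorial) with hp
  have hrad : p.radius = ⊤ := by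
    refine FormalMultilinearSeries.radius_eq_top_of_summable_norm _ fun r => ?_
    have hs : Summable fun m : ℕ => (C * r) ^ m / m.factorial :=
      Real.summable_pow_div_factorial _
    refine Summable.of_nonneg_of_le (fun m => by positivity) (fun m => ?_) hs
    rw [hp, FormalMultilinearSeries.ofScalars_norm, norm_div, Complex.norm_natCast, mul_pow,
      div_mul_eq_mul_div]
    gcongr
    exact hℓ m
  have hball : HasFPowerSeriesOnBall p.sum p 0 ⊤ := by
    have := p.hasFPowerSeriesOnBall (by rw [hrad]; exact ENNReal.zero_lt_top)
    rwa [hrad] at this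
  have hsum : ∀ z, p.sum z = ∑' m, ℓ m * (z ^ m / m.factorial) := by
    intro z
    rw [FormalMultilinearSeries.sum]
    refine tsum_congr fun m => ?_
    rw [hp, FormalMultilinearSeries.ofScalars_apply_eq]
    simp only [smul_eq_mul]; ring
  have hdiff : Differentiable ℂ p.sum := by
    intro z
    exact (hball.analyticAt_of_mem (by simp)).differentiableAt
  have hz := eq_zero_of_forall_mem_eq_zero hdiff h0 fun t ht => by rw [hsum]; exact h t ht
  have hp0 : p = 0 := hball.hasFPowerSeriesAt.eq_zero_of_eventually (Eventually.of_forall hz)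
  have h1 : p m (fun _ => 1) = 0 := by rw [hp0]; simp
  rw [hp, FormalMultilinearSeries.ofScalars_apply_eq] at h1
  have hf : (m.factorial : ℂ) ≠ 0 := by exact_mod_cast m.factorial_ne_zero
  simpa [hf] using h1

end Moments

end LDR

namespace LDR

/-! ### Exponential sums that tend to zero on a set of positive measure -/

section Limits

variable {N σ : Type*} [DecidableEq σ]

/-- A normal families argument. If the total size `A n` of the first moments stayed away from zero,
the moments divided by `A n` would converge to the Taylor coefficients of an entire function that
vanishes on `E`. All limits would be zero, although the first `B.card` normalized moments have norms
summing to one. -/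
lemma tendsto_moments_zero (𝒰 : Ultrafilter N) (B : Finset σ) (c : N → σ → ℂ) (l : N → σ → ℝ)
    {L : ℝ} (hL : 1 ≤ L) (hl : ∀ i ∈ B, ∀ᶠ n in (𝒰 : Filter N), |l n i| ≤ L) {E : Set ℝ}
    (h0 : volume E ≠ 0)
    (h : ∀ t ∈ E, Tendsto (fun n => ∑ i ∈ B, c n i * Complex.exp (l n i * (t : ℂ))) 𝒰 (𝓝 0)) :
    Tendsto (fun n => ∑ m ∈ Finset.range B.card, ‖∑ i ∈ B, c n i * (l n i : ℂ) ^ m‖) 𝒰 (𝓝 0) := by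
  set A : N → ℝ := fun n => ∑ m ∈ Finset.range B.card, ‖∑ i ∈ B, c n i * (l n i : ℂ) ^ m‖ with hA
  have hA0 : ∀ n, 0 ≤ A n := fun n => Finset.sum_nonneg fun _ _ => norm_nonneg _
  have hl' : ∀ᶠ n in (𝒰 : Filter N), ∀ i ∈ B, |l n i| ≤ L := by
    rw [Filter.eventually_all_finset]; exact hl
  by_contra hcon
  rw [Metric.tendsto_nhds] at hcon
  push Not at hcon
  obtain ⟨δ, hδ, hev⟩ := hcon
  have hev : ∀ᶠ n in (𝒰 : Filter N), δ ≤ A n := by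
    have hev' : ∀ᶠ n in (𝒰 : Filter N), ¬ dist (A n) 0 < δ := by simpa using hev
    filter_upwards [hev'] with n hn
    rwa [Real.dist_eq, sub_zero, abs_of_nonneg (hA0 n), not_lt] at hn
  set g : N → ℕ → ℂ := fun n m => (∑ i ∈ B, c n i * (l n i : ℂ) ^ m) / A n with hg
  have hgb : ∀ᶠ n in (𝒰 : Filter N), ∀ m, ‖g n m‖ ≤ (3 * L) ^ m := by
    filter_upwards [hev, hl'] with n hn hln m
    have hpos : 0 < A n := hδ.trans_le hn
    have := moment_bound hL (l n) B (c n) (A n) (hA0 n) hln (fun m hm =>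
      Finset.single_le_sum (f := fun m => ‖∑ i ∈ B, c n i * (l n i : ℂ) ^ m‖)
        (fun _ _ => norm_nonneg _) (Finset.mem_range.2 hm)) m
    rw [hg]
    simp only [norm_div, Complex.norm_real, Real.norm_eq_abs, abs_of_pos hpos]
    rw [div_le_iff₀ hpos]; linarith
  have hex : ∀ m, ∃ ℓ, Tendsto (fun n => g n m) 𝒰 (𝓝 ℓ) := fun m =>
    tendsto_of_bounded 𝒰 (a := 0) (C := (3 * L) ^ m) (by
      filter_upwards [hgb] with n hn
      simpa using hn m)
  choose ℓ hℓ using hex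
  have hℓb : ∀ m, ‖ℓ m‖ ≤ (3 * L) ^ m := fun m =>
    le_of_tendsto (hℓ m).norm (by filter_upwards [hgb] with n hn using hn m)
  have hzero : ∀ m, ℓ m = 0 := by
    refine coeff_eq_zero hℓb h0 fun t ht => ?_
    have hlim : Tendsto (fun n => ∑' m, g n m * ((t : ℂ) ^ m / m.factorial)) 𝒰
        (𝓝 (∑' m, ℓ m * ((t : ℂ) ^ m / m.factorial))) := by
      refine tendsto_tsum_of_dominated_convergence
        (bound := fun m : ℕ => (3 * L * |t|) ^ m / m.factorial)
        (Real.summable_pow_div_factorial _) (fun m => (hℓ m).mul_const _) ?_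
      filter_upwards [hgb] with n hn m
      have hnm := hn m
      rw [norm_mul, norm_div ((t : ℂ) ^ m), norm_pow, Complex.norm_natCast, Complex.norm_real,
        mul_pow, mul_div_assoc, Real.norm_eq_abs]
      gcongr
    have hlim0 : Tendsto (fun n => ∑' m, g n m * ((t : ℂ) ^ m / m.factorial)) 𝒰 (𝓝 0) := by
      refine squeeze_zero_norm' (a := fun n => ‖∑ i ∈ B, c n i * Complex.exp (l n i * (t : ℂ))‖ / δ)
        ?_ (by simpa using (h t ht).norm.div_const δ)
      filter_upwards [hev] with n hn
      have hs := (hasSum_expSum B (c n) (l n) 0 t).div_const (A n : ℂ)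
      simp only [pow_zero, mul_one, zero_add] at hs
      have : ∑' m, g n m * ((t : ℂ) ^ m / m.factorial) =
          (∑ i ∈ B, c n i * Complex.exp (l n i * (t : ℂ))) / A n := by
        rw [← hs.tsum_eq]
        exact tsum_congr fun m => by rw [hg]; ring
      rw [this, norm_div, Complex.norm_real, Real.norm_eq_abs, abs_of_nonneg (hA0 n)]
      gcongr
    exact tendsto_nhds_unique hlim hlim0
  have hone : Tendsto (fun n => ∑ m ∈ Finset.range B.card, ‖g n m‖) 𝒰
      (𝓝 (∑ m ∈ Finset.range B.card, ‖ℓ m‖)) := tendsto_finsetSum _ fun m _ => (hℓ m).norm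
  simp only [hzero, norm_zero, Finset.sum_const_zero] at hone
  have hone' : Tendsto (fun n => ∑ m ∈ Finset.range B.card, ‖g n m‖) 𝒰 (𝓝 1) := by
    refine tendsto_const_nhds.congr' ?_
    filter_upwards [hev] with n hn
    have hpos : 0 < A n := hδ.trans_le hn
    simp only [hg, norm_div, Complex.norm_real, Real.norm_eq_abs, abs_of_pos hpos]
    rw [← Finset.sum_div]
    exact (div_self hpos.ne').symm
  exact zero_ne_one (tendsto_nhds_unique hone hone')

/-- If an exponential sum of bounded length tends to zero on a set of positive measure, then so
does the part of it formed by the bounded frequencies, in the sense of moments. -/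
lemma bounded_part_tendsto_zero (𝒰 : Ultrafilter N) (B : Finset σ) (l : N → σ → ℝ)
    {L : ℝ} (hL : 1 ≤ L) (hl : ∀ i ∈ B, ∀ᶠ n in (𝒰 : Filter N), |l n i| ≤ L) (U : Finset σ) :
    ∀ (c : N → σ → ℂ) (E : Set ℝ), Disjoint B U →
    (∀ i ∈ U, Tendsto (fun n => l n i) 𝒰 atTop ∨ Tendsto (fun n => l n i) 𝒰 atBot) →
    MeasurableSet E → volume E ≠ 0 →
    (∀ t ∈ E, Tendsto (fun n => ∑ i ∈ B ∪ U, c n i * Complex.exp (l n i * (t : ℂ))) 𝒰 (𝓝 0)) →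
    ∃ ε : N → ℝ, Tendsto ε 𝒰 (𝓝 0) ∧
      ∀ᶠ n in (𝒰 : Filter N), ∀ m, ‖∑ i ∈ B, c n i * (l n i : ℂ) ^ m‖ ≤ ε n * (3 * L) ^ m := by
  have hl' : ∀ᶠ n in (𝒰 : Filter N), ∀ i ∈ B, |l n i| ≤ L := by
    rw [Filter.eventually_all_finset]; exact hl
  have hmom : ∀ c : N → σ → ℂ, ∀ᶠ n in (𝒰 : Filter N), ∀ m, ‖∑ i ∈ B, c n i * (l n i : ℂ) ^ m‖ ≤
      (∑ m ∈ Finset.range B.card, ‖∑ i ∈ B, c n i * (l n i : ℂ) ^ m‖) * (3 * L) ^ m := by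
    intro c
    filter_upwards [hl'] with n hn
    exact moment_bound hL (l n) B (c n) _ (Finset.sum_nonneg fun _ _ => norm_nonneg _) hn
      (fun m hm => Finset.single_le_sum (f := fun m => ‖∑ i ∈ B, c n i * (l n i : ℂ) ^ m‖)
        (fun _ _ => norm_nonneg _) (Finset.mem_range.2 hm))
  induction U using Finset.induction_on with
  | empty =>
    intro c E _ _ hE h0 h
    simp only [Finset.union_empty] at h
    exact ⟨_, tendsto_moments_zero 𝒰 B c l hL hl h0 h, hmom c⟩
  | insert i₀ U hi ih =>
    intro c E hdis hU hE h0 h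
    have hi₀B : i₀ ∉ B := fun hB => Finset.disjoint_left.1 hdis hB (Finset.mem_insert_self _ _)
    -- The sign of `τ` is that of the diverging frequency, so that `exp (-(l n i₀ * τ))` tends to
    -- zero.
    obtain ⟨τ, E', hτ, hE', h0', hsub, hsub'⟩ : ∃ (τ : ℝ) (E' : Set ℝ),
        Tendsto (fun n => l n i₀ * τ) 𝒰 atTop ∧ MeasurableSet E' ∧ volume E' ≠ 0 ∧ E' ⊆ E ∧
        ∀ t ∈ E', t + τ ∈ E := by
      obtain ⟨τ, hτ, hvol⟩ := exists_pos_inter_translate hE h0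
      rcases hU i₀ (Finset.mem_insert_self _ _) with htop | hbot
      · exact ⟨τ, E ∩ (fun t => t + τ) ⁻¹' E, htop.atTop_mul_const hτ,
          hE.inter ((measurable_add_const τ) hE), hvol, Set.inter_subset_left, fun t ht => ht.2⟩
      · refine ⟨-τ, E ∩ (fun t => t + -τ) ⁻¹' E, ?_,
          hE.inter ((measurable_add_const (-τ)) hE), ?_, Set.inter_subset_left, fun t ht => ht.2⟩
        · exact hbot.atBot_mul_const_of_neg (by linarith)
        · rw [← measure_preimage_add_right volume τ]
          convert hvol using 2
          ext t; simp [and_comm]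
    have hη : Tendsto (fun n => Real.exp (-(l n i₀ * τ))) 𝒰 (𝓝 0) :=
      Real.tendsto_exp_atBot.comp (tendsto_neg_atTop_atBot.comp hτ)
    -- These are the coefficients of `F t - exp (-(l n i₀ * τ)) * F (t + τ)`, where `F` is the given
    -- sum. The term `i₀` drops out, while the factors at bounded frequencies tend to one.
    set c' : N → σ → ℂ := fun n i => c n i * (1 - Complex.exp ((l n i - l n i₀) * τ)) with hc'
    obtain ⟨ε, hε, hεb⟩ := ih c' E' (Finset.disjoint_of_subset_right (Finset.subset_insert _ _) hdis)
      (fun i hi => hU i (Finset.mem_insert_of_mem hi)) hE' h0' (by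
        intro t ht
        have h1 := h t (hsub ht)
        have h2 := h (t + τ) (hsub' t ht)
        have hηc : Tendsto (fun n => ((Real.exp (-(l n i₀ * τ)) : ℝ) : ℂ)) 𝒰 (𝓝 0) := by
          have := (Complex.continuous_ofReal.tendsto 0).comp hη
          rwa [Complex.ofReal_zero] at this
        have h3 := h1.sub (hηc.mul h2)
        rw [mul_zero, sub_zero] at h3
        refine h3.congr fun n => ?_
        rw [Finset.mul_sum, ← Finset.sum_sub_distrib, Finset.union_insert, Finset.sum_insert
          (by simp [hi, hi₀B])]
        have e1 : ∀ i, c n i * Complex.exp (l n i * (t : ℂ)) -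
            ((Real.exp (-(l n i₀ * τ)) : ℝ) : ℂ) * (c n i * Complex.exp (l n i * ((t + τ : ℝ) : ℂ)))
            = c' n i * Complex.exp (l n i * (t : ℂ)) := by
          intro i
          have : Complex.exp ((l n i - l n i₀) * τ) * Complex.exp (l n i * (t : ℂ)) =
              Complex.exp (-(l n i₀ * τ)) * Complex.exp (l n i * (t + τ)) := by
            rw [← Complex.exp_add, ← Complex.exp_add]; ring_nf
          rw [hc']
          push_cast
          linear_combination (c n i) * this
        rw [Finset.sum_congr rfl fun i _ => e1 i, e1 i₀]
        simp [hc'])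
    set A : N → ℝ := fun n => ∑ m ∈ Finset.range B.card, ‖∑ i ∈ B, c n i * (l n i : ℂ) ^ m‖ with hA
    have hA0 : ∀ n, 0 ≤ A n := fun n => Finset.sum_nonneg fun _ _ => norm_nonneg _
    set M : ℝ := ∑ m ∈ Finset.range B.card, (3 * L) ^ m with hM
    have hM0 : 0 ≤ M := Finset.sum_nonneg fun _ _ => by positivity
    set K : ℝ := M * Real.exp (3 * L * |τ|) with hK
    -- Passing back from `c'` to `c` costs at most `exp (-(l n i₀ * τ)) * K * A n`. Once this is at
    -- most half of `A n`, it can be absorbed in the left side, which accounts for the factor `2` in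
    -- the new `ε`.
    have hηK : ∀ᶠ n in (𝒰 : Filter N), Real.exp (-(l n i₀ * τ)) * K ≤ 1 / 2 := by
      have := hη.mul_const K
      rw [zero_mul] at this
      exact (this.eventually_lt_const (by norm_num : (0 : ℝ) < 1 / 2)).mono fun n hn => hn.le
    refine ⟨fun n => 2 * (ε n * M), by simpa using (hε.mul_const M).const_mul 2, ?_⟩
    filter_upwards [hεb, hmom c, hηK] with n hn hmn hηn m
    refine (hmn m).trans ?_
    gcongr
    change A n ≤ _
    have hstep : ∀ m, ‖∑ i ∈ B, c n i * (l n i : ℂ) ^ m‖ ≤ ε n * (3 * L) ^ m +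
        Real.exp (-(l n i₀ * τ)) * (A n * (3 * L) ^ m * Real.exp (3 * L * |τ|)) := by
      intro m
      have h1 := norm_expSum_le (S := B) (c := c n) (l := l n) (A := A n) (C := 3 * L) hmn m τ
      have h2 : ∑ i ∈ B, c n i * (l n i : ℂ) ^ m = ∑ i ∈ B, c' n i * (l n i : ℂ) ^ m +
          ((Real.exp (-(l n i₀ * τ)) : ℝ) : ℂ) *
            ∑ i ∈ B, c n i * (l n i : ℂ) ^ m * Complex.exp (l n i * (τ : ℂ)) := by
        rw [Finset.mul_sum, ← Finset.sum_add_distrib]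
        refine Finset.sum_congr rfl fun i _ => ?_
        have : Complex.exp ((l n i - l n i₀) * τ) =
            Complex.exp (-(l n i₀ * τ)) * Complex.exp (l n i * τ) := by
          rw [← Complex.exp_add]; ring_nf
        rw [hc']
        push_cast
        simp only [this]
        ring
      rw [h2]
      refine (norm_add_le _ _).trans (add_le_add (hn m) ?_)
      rw [norm_mul, Complex.norm_real, Real.norm_eq_abs, Real.abs_exp]
      gcongr
      simpa using h1
    have hsum : A n ≤ ε n * M + (Real.exp (-(l n i₀ * τ)) * K) * A n := by
      calc A n ≤ ∑ m ∈ Finset.range B.card, (ε n * (3 * L) ^ m +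
          Real.exp (-(l n i₀ * τ)) * (A n * (3 * L) ^ m * Real.exp (3 * L * |τ|))) :=
            Finset.sum_le_sum fun m _ => hstep m
        _ = _ := by
            rw [Finset.sum_add_distrib, ← Finset.mul_sum, ← Finset.mul_sum, ← Finset.sum_mul,
              ← Finset.mul_sum, hK, hM]
            ring
    nlinarith [hA0 n]

end Limits

end LDR

namespace LDR

/-! ## Subset sums with signs -/

/-- `tanh u` in terms of `x = exp (2 u)`. -/
noncomputable def nodeFrac (x : ℂ) : ℂ := (x - 1) / (1 + x)

section Signs

variable {ι : Type*} [Fintype ι]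

lemma sum_prod_eq (x : ι → ℂ) : ∑ R : Finset ι, ∏ i ∈ R, x i = ∏ i, (1 + x i) := by
  rw [Finset.prod_one_add, Finset.powerset_univ]

variable [DecidableEq ι]

/-- `+1` for the elements of `R`, `-1` for the others. -/
def memSign (R : Finset ι) (i : ι) : ℂ := if i ∈ R then 1 else -1

/-- Expand the product in which the factor `1 + x i` is replaced by `x i - 1`: subsets that omit `i`
acquire a minus sign. -/
lemma sum_memSign_mul_prod (x : ι → ℂ) (i : ι) (hi : 1 + x i ≠ 0) :
    ∑ R : Finset ι, memSign R i * ∏ j ∈ R, x j = nodeFrac (x i) * ∏ j, (1 + x j) := by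
  have h1 := Finset.prod_add x (fun j => if j = i then (-1 : ℂ) else 1) Finset.univ
  rw [Finset.powerset_univ] at h1
  have h2 : ∀ R : Finset ι, ∏ j ∈ Finset.univ \ R, (if j = i then (-1 : ℂ) else 1) =
      memSign R i := by
    intro R
    rw [Finset.prod_ite_eq']
    by_cases h : i ∈ R <;> simp [memSign, h]
  have h3 : ∏ j, (x j + if j = i then (-1 : ℂ) else 1) =
      nodeFrac (x i) * ∏ j, (1 + x j) := by
    rw [nodeFrac, ← Finset.mul_prod_erase _ _ (Finset.mem_univ i),
      ← Finset.mul_prod_erase Finset.univ (fun j => 1 + x j) (Finset.mem_univ i), ← mul_assoc,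
      div_mul_cancel₀ _ hi]
    congr 1
    · simp [sub_eq_add_neg]
    · refine Finset.prod_congr rfl fun j hj => ?_
      rw [if_neg (Finset.ne_of_mem_erase hj), add_comm]
  rw [← h3, h1]
  exact Finset.sum_congr rfl fun R _ => by rw [h2, mul_comm]

/-- Clearing denominators in a network output produces a sum over pairs of subsets. The identity is
stated for a restricted family `𝒮` because only subsets of saturated nodes with bounded total
frequency will be kept. -/
lemma sum_sign_decomposition {κ : Type*} [Fintype κ] [DecidableEq κ] (α : ℂ) (a x : ι → ℂ)
    (b y : κ → ℂ) (𝒮 : Finset (Finset κ)) (hx : ∀ i, 1 + x i ≠ 0) :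
    ∑ q ∈ Finset.univ ×ˢ 𝒮, (α + ∑ i, memSign q.1 i * a i + ∑ i, memSign q.2 i * b i) *
        ((∏ i ∈ q.1, x i) * ∏ i ∈ q.2, y i) =
      (∏ i, (1 + x i)) * ((α + ∑ i, a i * nodeFrac (x i)) * ∑ S ∈ 𝒮, ∏ i ∈ S, y i +
        ∑ S ∈ 𝒮, (∑ i, memSign S i * b i) * ∏ i ∈ S, y i) := by
  rw [Finset.sum_product_right, mul_add, Finset.mul_sum, Finset.mul_sum, Finset.mul_sum,
    ← Finset.sum_add_distrib]
  refine Finset.sum_congr rfl fun S _ => ?_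
  have h1 : ∑ R : Finset ι, (∑ i, memSign R i * a i) * ∏ j ∈ R, x j =
      (∑ i, a i * nodeFrac (x i)) * ∏ j, (1 + x j) := by
    simp only [Finset.sum_mul]
    rw [Finset.sum_comm]
    refine Finset.sum_congr rfl fun i _ => ?_
    rw [mul_assoc, ← sum_memSign_mul_prod x i (hx i), Finset.mul_sum]
    exact Finset.sum_congr rfl fun R _ => by ring
  have h2 : ∀ R : Finset ι, (α + ∑ i, memSign R i * a i + ∑ i, memSign S i * b i) *
      ((∏ i ∈ R, x i) * ∏ i ∈ S, y i) = ((α + ∑ i, memSign S i * b i) * ∏ i ∈ S, y i) *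
        (∏ i ∈ R, x i) + (∏ i ∈ S, y i) * ((∑ i, memSign R i * a i) * ∏ i ∈ R, x i) := by
    intro R; ring
  simp only [h2, Finset.sum_add_distrib, ← Finset.mul_sum, h1, sum_prod_eq]
  ring

end Signs

/-! ## Contour integrals of hidden nodes -/

/-- The exponential `exp (2 (w z + b))`. -/
noncomputable def nodeExp (w b : ℝ) (z : ℂ) : ℂ := Complex.exp (2 * (w * z + b))

lemma differentiable_nodeExp (w b : ℝ) : Differentiable ℂ (nodeExp w b) := by
  unfold nodeExp; fun_prop

lemma continuous_nodeExp : Continuous fun q : (ℝ × ℝ) × ℂ => nodeExp q.1.1 q.1.2 q.2 := by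
  unfold nodeExp; fun_prop

lemma differentiableAt_nodeFrac {w b : ℝ} {z : ℂ} (h : 1 + nodeExp w b z ≠ 0) :
    DifferentiableAt ℂ (fun z => nodeFrac (nodeExp w b z)) z := by
  unfold nodeFrac
  have := differentiable_nodeExp w b z
  exact (this.sub_const 1).div (this.const_add 1) h

lemma circleIntegral_eq_zero {F : ℂ → ℂ} {c : ℂ} {r : ℝ} (hr : 0 ≤ r)
    (h : ∀ z ∈ Metric.closedBall c r, DifferentiableAt ℂ F z) : ∮ z in C(c, r), F z = 0 :=
  Complex.circleIntegral_eq_zero_of_differentiable_on_off_countable hr Set.countable_empty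
    (fun z hz => (h z hz).continuousAt.continuousWithinAt)
    fun z hz => h z (Metric.ball_subset_closedBall hz.1)

lemma exp_two_mul_ne_one {v : ℂ} (h0 : v ≠ 0) (hv : ‖v‖ < Real.pi) :
    Complex.exp (2 * v) ≠ 1 := by
  intro h
  obtain ⟨n, hn⟩ := Complex.exp_eq_one_iff.1 h
  have hv' : v = n * (Real.pi * Complex.I) := by linear_combination hn / 2
  have hn0 : n ≠ 0 := by rintro rfl; simp [hv'] at h0
  have h1 : (1 : ℝ) ≤ |(n : ℝ)| := by exact_mod_cast Int.one_le_abs hn0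
  rw [hv', norm_mul, norm_mul, Complex.norm_I, Complex.norm_real, Complex.norm_intCast, mul_one,
    Real.norm_eq_abs, abs_of_pos Real.pi_pos] at hv
  nlinarith [Real.pi_pos]

lemma nodeExp_eq_of_pole {w b : ℝ} {p : ℂ} (hp : 1 + nodeExp w b p = 0) (z : ℂ) :
    nodeExp w b z = -Complex.exp (2 * (w * (z - p))) := by
  have : nodeExp w b z = Complex.exp (2 * (w * (z - p))) * nodeExp w b p := by
    rw [nodeExp, nodeExp, ← Complex.exp_add]; ring_nf
  rw [this]; linear_combination Complex.exp (2 * (w * (z - p))) * hp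

/-- Near the pole `p` the node is the hyperbolic cotangent of `w * (z - p)`, with residue `1 / w`.
Poles are spaced by `π / |w|`, so the bound on `r` keeps all others out of the disc. -/
lemma circleIntegral_nodeFrac {w b : ℝ} {c p : ℂ} {r : ℝ} (hw : w ≠ 0)
    (hp : p ∈ Metric.ball c r) (hpole : 1 + nodeExp w b p = 0) (hr : 2 * (|w| * r) < Real.pi) :
    ∮ z in C(c, r), nodeFrac (nodeExp w b z) = 2 * Real.pi * Complex.I / w := by
  have hr0 : 0 < r := dist_nonneg.trans_lt (Metric.mem_ball.1 hp)
  -- This is `(exp (2 v) - 1) / v` with its singularity at `0` removed; it lets Cauchy's formula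
  -- apply to `G z / (z - p)`.
  set φ : ℂ → ℂ := dslope (fun v => Complex.exp (2 * v)) 0 with hφ
  have hφd : Differentiable ℂ φ := by
    rw [← differentiableOn_univ, hφ, Complex.differentiableOn_dslope univ_mem]
    exact Differentiable.differentiableOn (by fun_prop)
  have hφ0 : φ 0 = 2 := by
    rw [hφ, dslope_same]
    have : HasDerivAt (fun v : ℂ => Complex.exp (2 * v)) 2 0 := by
      simpa using ((hasDerivAt_id (0 : ℂ)).const_mul 2).cexp
    exact this.deriv
  have hφv : ∀ v, v ≠ 0 → φ v = (Complex.exp (2 * v) - 1) / v := by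
    intro v hv
    rw [hφ, dslope_of_ne _ hv, slope_def_field]; simp
  have hφne : ∀ v, ‖v‖ < Real.pi → φ v ≠ 0 := by
    intro v hv
    by_cases h0 : v = 0
    · rw [h0, hφ0]; norm_num
    · rw [hφv v h0]
      exact div_ne_zero (sub_ne_zero.2 (exp_two_mul_ne_one h0 hv)) h0
  have hnorm : ∀ z ∈ Metric.closedBall c r, ‖(w : ℂ) * (z - p)‖ < Real.pi := by
    intro z hz
    rw [norm_mul, Complex.norm_real, Real.norm_eq_abs]
    have : ‖z - p‖ ≤ 2 * r := by
      rw [← dist_eq_norm]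
      have := dist_triangle z c p
      rw [Metric.mem_closedBall] at hz
      rw [Metric.mem_ball, dist_comm] at hp
      linarith
    calc |w| * ‖z - p‖ ≤ |w| * (2 * r) := by gcongr
      _ < Real.pi := by linarith
  have hwc : (w : ℂ) ≠ 0 := by exact_mod_cast hw
  set G : ℂ → ℂ := fun z => (Complex.exp (2 * (w * (z - p))) + 1) / (w * φ (w * (z - p))) with hG
  have hGd : DifferentiableOn ℂ G (Metric.closedBall c r) := by
    intro z hz
    have h1 : DifferentiableAt ℂ (fun z => φ (w * (z - p))) z :=
      DifferentiableAt.comp z (hφd _) (by fun_prop)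
    refine DifferentiableAt.differentiableWithinAt ?_
    exact DifferentiableAt.div (by fun_prop) (h1.const_mul _)
      (mul_ne_zero hwc (hφne _ (hnorm z hz)))
  have key := hGd.circleIntegral_sub_inv_smul hp
  have hcongr : ∮ z in C(c, r), nodeFrac (nodeExp w b z) = ∮ z in C(c, r), (z - p)⁻¹ • G z := by
    refine circleIntegral.integral_congr hr0.le fun z hz => ?_
    have hzp : z - p ≠ 0 := by
      rw [sub_ne_zero]; rintro rfl
      rw [Metric.mem_sphere] at hz
      rw [Metric.mem_ball] at hp
      linarith
    have hv : (w : ℂ) * (z - p) ≠ 0 := mul_ne_zero hwc hzp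
    have hne := exp_two_mul_ne_one hv (hnorm z (Metric.sphere_subset_closedBall hz))
    have h1 : Complex.exp (2 * (w * (z - p))) - 1 ≠ 0 := sub_ne_zero.2 hne
    have h2 : 1 + -Complex.exp (2 * (w * (z - p))) ≠ 0 := by
      intro h; apply h1; linear_combination -h
    simp only [nodeFrac, nodeExp_eq_of_pole hpole, hG, hφv _ hv, smul_eq_mul]
    generalize Complex.exp (2 * (w * (z - p))) = e at h1 h2
    rw [show (z - p)⁻¹ * ((e + 1) / (w * ((e - 1) / (w * (z - p))))) = (e + 1) / (e - 1) by
      field_simp]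
    rw [div_eq_div_iff h2 h1]
    ring
  rw [hcongr, key, hG]
  simp only [sub_self, mul_zero, hφ0, Complex.exp_zero, smul_eq_mul]
  field_simp
  norm_num

lemma eventually_le_norm_one_add_nodeExp {W β : ℝ} {K : Set ℂ} (hK : IsCompact K)
    (h : ∀ z ∈ K, 1 + nodeExp W β z ≠ 0) :
    ∃ δ > 0, ∀ᶠ q : ℝ × ℝ in 𝓝 (W, β), ∀ z ∈ K, δ ≤ ‖1 + nodeExp q.1 q.2 z‖ := by
  have hcont : Continuous fun q : (ℝ × ℝ) × ℂ => ‖1 + nodeExp q.1.1 q.1.2 q.2‖ :=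
    (continuous_const.add continuous_nodeExp).norm
  obtain ⟨δ, hδ, hδK⟩ : ∃ δ > 0, ∀ z ∈ K, δ < ‖1 + nodeExp W β z‖ := by
    rcases K.eq_empty_or_nonempty with rfl | hne
    · exact ⟨1, one_pos, by simp⟩
    obtain ⟨z₀, hz₀, hmin⟩ := hK.exists_isMinOn hne
      (f := fun z => ‖1 + nodeExp W β z‖) (hcont.comp (by fun_prop :
        Continuous fun z : ℂ => (((W, β) : ℝ × ℝ), z))).continuousOn
    have hpos : 0 < ‖1 + nodeExp W β z₀‖ := norm_pos_iff.2 (h z₀ hz₀)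
    exact ⟨_, half_pos hpos, fun z hz => (half_lt_self hpos).trans_le (hmin hz)⟩
  refine ⟨δ, hδ, hK.eventually_forall_of_forall_eventually fun z hz => ?_⟩
  have := hcont.tendsto ((W, β), z)
  exact (this.eventually_const_lt (hδK z hz)).mono fun q hq => hq.le

end LDR

namespace LDR

lemma prod_nodeExp {ι : Type*} (R : Finset ι) (w b : ι → ℝ) (z : ℂ) :
    ∏ i ∈ R, nodeExp (w i) (b i) z = nodeExp (∑ i ∈ R, w i) (∑ i ∈ R, b i) z := by
  simp only [nodeExp]
  rw [← Complex.exp_sum, ← Finset.mul_sum, Finset.sum_add_distrib, ← Finset.sum_mul]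
  push_cast
  rfl

lemma nodeExp_ofReal (w b t : ℝ) : nodeExp w b t = (Real.exp (2 * (w * t + b)) : ℝ) := by
  rw [nodeExp]; push_cast; rfl

lemma norm_nodeExp (w b : ℝ) (z : ℂ) : ‖nodeExp w b z‖ = Real.exp (2 * (w * z.re + b)) := by
  rw [nodeExp, Complex.norm_exp]; simp

lemma one_add_nodeExp_ofReal_ne_zero (w b t : ℝ) : 1 + nodeExp w b t ≠ 0 := by
  rw [nodeExp_ofReal]
  have : 0 < 1 + Real.exp (2 * (w * t + b)) := by positivity
  exact_mod_cast this.ne'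

lemma nodeFrac_nodeExp_ofReal (w b t : ℝ) :
    nodeFrac (nodeExp w b t) = (Real.tanh (w * t + b) : ℝ) := by
  rw [nodeExp_ofReal, nodeFrac, Real.tanh_eq_sinh_div_cosh, Real.sinh_eq, Real.cosh_eq, two_mul,
    Real.exp_add, Real.exp_neg]
  have h1 : (Real.exp (w * t + b) : ℂ) ≠ 0 := by exact_mod_cast (Real.exp_pos _).ne'
  have h2 : (1 + Real.exp (w * t + b) * Real.exp (w * t + b) : ℂ) ≠ 0 := by
    have : 0 < 1 + Real.exp (w * t + b) * Real.exp (w * t + b) := by positivity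
    exact_mod_cast this.ne'
  have h3 : (Real.exp (w * t + b) : ℂ) + (Real.exp (w * t + b) : ℂ)⁻¹ ≠ 0 := by
    have : 0 < Real.exp (w * t + b) + (Real.exp (w * t + b))⁻¹ := by positivity
    exact_mod_cast this.ne'
  push_cast at *
  generalize Complex.exp (w * t + b) = e at *
  field_simp
  ring

/-! ### Residues of networks with convergent and saturated nodes -/

section Residue

variable {N : Type*}

/-- At `t₀` each product over a nonempty `S` tends to zero. Its total frequency is bounded, so
moving from `t₀` to a point of a fixed disc changes the norm only by a bounded factor. The
individual nodes need not be small off the real set. -/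
lemma eventually_norm_sum_le_half (𝒰 : Ultrafilter N) {κ : Type*} [DecidableEq κ] (w b : N → κ → ℝ)
    {t₀ : ℝ} (hv : ∀ j, Tendsto (fun n => w n j * t₀ + b n j) 𝒰 atBot) (𝒮 : Finset (Finset κ))
    (h𝒮 : ∀ S ∈ 𝒮, ∃ l, Tendsto (fun n => ∑ j ∈ S, w n j) 𝒰 (𝓝 l)) (R : ℝ) :
    ∀ᶠ n in (𝒰 : Filter N), ∀ z : ℂ, ‖z‖ ≤ R →
      ‖∑ S ∈ 𝒮.erase ∅, ∏ j ∈ S, nodeExp (w n j) (b n j) z‖ ≤ 1 / 2 := by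
  have key : ∀ S ∈ 𝒮.erase ∅, ∃ η : N → ℝ, Tendsto η 𝒰 (𝓝 0) ∧
      ∀ᶠ n in (𝒰 : Filter N), ∀ z : ℂ, ‖z‖ ≤ R →
        ‖∏ j ∈ S, nodeExp (w n j) (b n j) z‖ ≤ η n := by
    intro S hS
    obtain ⟨hne, hmem⟩ := Finset.mem_erase.1 hS
    obtain ⟨l, hl⟩ := h𝒮 S hmem
    have hbd : ∀ᶠ n in (𝒰 : Filter N), |∑ j ∈ S, w n j| ≤ |l| + 1 :=
      (hl.abs.eventually_lt_const (lt_add_one _)).mono fun n hn => hn.le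
    refine ⟨fun n => (∏ j ∈ S, Real.exp (2 * (w n j * t₀ + b n j))) *
      Real.exp (2 * ((|l| + 1) * (R + |t₀|))), ?_, ?_⟩
    · have h1 : Tendsto (fun n => ∏ j ∈ S, Real.exp (2 * (w n j * t₀ + b n j))) 𝒰
          (𝓝 (∏ j ∈ S, 0)) := tendsto_finsetProd _ fun j _ =>
        Real.tendsto_exp_atBot.comp ((hv j).const_mul_atBot two_pos)
      rw [Finset.prod_const, zero_pow (Finset.card_ne_zero.2 (Finset.nonempty_iff_ne_empty.2 hne))]
        at h1
      simpa using h1.mul_const _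
    · filter_upwards [hbd] with n hn z hz
      rw [prod_nodeExp, norm_nodeExp, ← Real.exp_sum, ← Real.exp_add]
      apply Real.exp_le_exp.2
      rw [← Finset.mul_sum, Finset.sum_add_distrib, ← Finset.sum_mul]
      have h1 : (∑ j ∈ S, w n j) * (z.re - t₀) ≤ (|l| + 1) * (R + |t₀|) := by
        refine (le_abs_self _).trans ?_
        rw [abs_mul]
        have h2 : |z.re - t₀| ≤ R + |t₀| :=
          (abs_sub _ _).trans (add_le_add ((Complex.abs_re_le_norm z).trans hz) le_rfl)
        gcongr
      linarith
  choose! η hη hηb using key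
  have hsum : Tendsto (fun n => ∑ S ∈ 𝒮.erase ∅, η S n) 𝒰 (𝓝 0) := by
    have := tendsto_finsetSum (𝒮.erase ∅) fun S hS => hη S hS
    simpa using this
  have hall : ∀ᶠ n in (𝒰 : Filter N), ∀ S ∈ 𝒮.erase ∅, ∀ z : ℂ, ‖z‖ ≤ R →
      ‖∏ j ∈ S, nodeExp (w n j) (b n j) z‖ ≤ η S n := by
    rw [Filter.eventually_all_finset]; exact hηb
  filter_upwards [hall, hsum.eventually_lt_const (by norm_num : (0 : ℝ) < 1 / 2)] with n hn hn' z hz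
  exact (norm_sum_le _ _).trans ((Finset.sum_le_sum fun S hS => hn S hS z hz).trans hn'.le)

variable {ι κ : Type*} [Fintype ι] [Fintype κ]

lemma exists_radius (W β : ι → ℝ) (c : ℂ) :
    ∃ r > 0, (∀ i, 1 + nodeExp (W i) (β i) c = 0 → 2 * (|W i| * r) < Real.pi) ∧
      (∀ i, 1 + nodeExp (W i) (β i) c ≠ 0 →
        ∀ z ∈ Metric.closedBall c r, 1 + nodeExp (W i) (β i) z ≠ 0) ∧
      ∀ i, ∀ z ∈ Metric.sphere c r, 1 + nodeExp (W i) (β i) z ≠ 0 := by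
  have h1 : ∀ᶠ r : ℝ in 𝓝[>] 0, ∀ i, 2 * (|W i| * r) < Real.pi := by
    rw [Filter.eventually_all]
    intro i
    have : Tendsto (fun r : ℝ => 2 * (|W i| * r)) (𝓝[>] 0) (𝓝 0) := by
      have : Tendsto (fun r : ℝ => 2 * (|W i| * r)) (𝓝 0) (𝓝 (2 * (|W i| * 0))) :=
        Continuous.tendsto (by fun_prop) _
      simpa using this.mono_left nhdsWithin_le_nhds
    exact this.eventually_lt_const Real.pi_pos
  have h2 : ∀ᶠ r : ℝ in 𝓝[>] 0, ∀ i, 1 + nodeExp (W i) (β i) c ≠ 0 →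
      ∀ z ∈ Metric.closedBall c r, 1 + nodeExp (W i) (β i) z ≠ 0 := by
    rw [Filter.eventually_all]
    intro i
    by_cases hi : 1 + nodeExp (W i) (β i) c = 0
    · simp [hi]
    have hopen : {z | 1 + nodeExp (W i) (β i) z ≠ 0} ∈ 𝓝 c :=
      (((differentiable_nodeExp _ _).continuous.const_add 1).tendsto c).eventually_ne hi
    filter_upwards [nhdsWithin_le_nhds (eventually_closedBall_subset hopen)] with r hr _ z hz
    exact hr hz
  obtain ⟨r, ⟨h1, h2⟩, hr⟩ := ((h1.and h2).and self_mem_nhdsWithin).exists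
  have hr : 0 < r := hr
  refine ⟨r, hr, fun i _ => h1 i, h2, fun i z hz => ?_⟩
  by_cases hi : 1 + nodeExp (W i) (β i) c = 0
  · rw [nodeExp_eq_of_pole hi]
    have hzc : ‖z - c‖ = r := by rwa [mem_sphere_iff_norm] at hz
    have hW : W i ≠ 0 := by
      intro h0
      have := one_add_nodeExp_ofReal_ne_zero 0 (β i) 0
      apply this
      rw [← hi, h0]
      simp [nodeExp]
    have hne := exp_two_mul_ne_one (v := W i * (z - c))
      (mul_ne_zero (by exact_mod_cast hW) (norm_pos_iff.1 (by rw [hzc]; exact hr))) (by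
        rw [norm_mul, hzc, Complex.norm_real, Real.norm_eq_abs]
        have := h1 i
        have h0 : 0 ≤ |W i| * r := by positivity
        linarith)
    intro h
    apply hne
    linear_combination -h
  · exact h2 i hi z (Metric.sphere_subset_closedBall hz)

variable [DecidableEq ι] [DecidableEq κ]

lemma sum_sign_eq (α : ℂ) (a x : ι → ℂ) (b y : κ → ℂ) (hx : ∀ i, 1 + x i ≠ 0)
    (hy : ∀ j, 1 + y j ≠ 0) :
    ∑ q : Finset ι × Finset κ, (α + ∑ i, memSign q.1 i * a i + ∑ i, memSign q.2 i * b i) *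
        ((∏ i ∈ q.1, x i) * ∏ i ∈ q.2, y i) =
      (∏ i, (1 + x i)) * (∏ j, (1 + y j)) *
        (α + ∑ i, a i * nodeFrac (x i) + ∑ j, b j * nodeFrac (y j)) := by
  have h5 : ∑ S : Finset κ, (∑ j, memSign S j * b j) * ∏ j ∈ S, y j =
      (∑ j, b j * nodeFrac (y j)) * ∏ j, (1 + y j) := by
    simp only [Finset.sum_mul]
    rw [Finset.sum_comm]
    refine Finset.sum_congr rfl fun j _ => ?_
    rw [mul_assoc, ← sum_memSign_mul_prod y j (hy j), Finset.mul_sum]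
    exact Finset.sum_congr rfl fun S _ => by ring
  rw [← Finset.univ_product_univ, sum_sign_decomposition α a x b y Finset.univ hx, sum_prod_eq, h5]
  ring

/-- The cleared denominators converge to a finite limit: factors of convergent nodes have limits,
and those of saturated nodes tend to one. -/
lemma tendsto_sum_sign_zero (𝒰 : Ultrafilter N) (α : N → ℝ) (a w b : N → ι → ℝ)
    (W β : ι → ℝ) (hW : ∀ i, Tendsto (fun n => w n i) 𝒰 (𝓝 (W i)))
    (hβ : ∀ i, Tendsto (fun n => b n i) 𝒰 (𝓝 (β i))) (a' w' b' : N → κ → ℝ) {t : ℝ}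
    (hv : ∀ j, Tendsto (fun n => w' n j * t + b' n j) 𝒰 atBot)
    (h : Tendsto (fun n => α n + ∑ i, a n i * Real.tanh (w n i * t + b n i) +
      ∑ j, a' n j * Real.tanh (w' n j * t + b' n j)) 𝒰 (𝓝 0)) :
    Tendsto (fun n => ∑ q : Finset ι × Finset κ,
      ((α n : ℂ) + ∑ i, memSign q.1 i * a n i + ∑ j, memSign q.2 j * a' n j) *
        ((∏ i ∈ q.1, nodeExp (w n i) (b n i) t) * ∏ j ∈ q.2, nodeExp (w' n j) (b' n j) t)) 𝒰
      (𝓝 0) := by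
  have h1 : Tendsto (fun n => ∏ i, (1 + nodeExp (w n i) (b n i) t)) 𝒰
      (𝓝 (∏ i, (1 + nodeExp (W i) (β i) t))) := tendsto_finsetProd _ fun i _ => by
    have hc : Continuous fun q : ℝ × ℝ => nodeExp q.1 q.2 t := by
      unfold nodeExp; fun_prop
    exact ((hc.tendsto (W i, β i)).comp ((hW i).prodMk_nhds (hβ i))).const_add 1
  have h2 : Tendsto (fun n => ∏ j, (1 + nodeExp (w' n j) (b' n j) t)) 𝒰
      (𝓝 (∏ j : κ, (fun _ : κ => (1 : ℂ) + 0) j)) := tendsto_finsetProd _ fun j _ => by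
    have : Tendsto (fun n => nodeExp (w' n j) (b' n j) t) 𝒰 (𝓝 0) := by
      rw [tendsto_zero_iff_norm_tendsto_zero]
      simp only [norm_nodeExp, Complex.ofReal_re]
      exact Real.tendsto_exp_atBot.comp ((hv j).const_mul_atBot two_pos)
    exact this.const_add 1
  have h3 := (Complex.continuous_ofReal.tendsto 0).comp h
  have h4 := (h1.mul h2).mul h3
  rw [Complex.ofReal_zero, mul_zero] at h4
  refine h4.congr fun n => ?_
  rw [sum_sign_eq (α n : ℂ) (fun i => (a n i : ℂ)) (fun i => nodeExp (w n i) (b n i) t)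
    (fun j => (a' n j : ℂ)) (fun j => nodeExp (w' n j) (b' n j) t)
    (fun i => one_add_nodeExp_ofReal_ne_zero _ _ _) fun j => one_add_nodeExp_ofReal_ne_zero _ _ _]
  simp only [nodeFrac_nodeExp_ofReal, Function.comp]
  push_cast
  rfl

open Classical in
/-- If a network output tends to zero on a set of positive measure, where some hidden nodes
converge and the others saturate, then so does its residue at each point of the complex plane. -/
theorem tendsto_residue_sum_zero (𝒰 : Ultrafilter N) (α : N → ℝ) (a w b : N → ι → ℝ)
    (W β : ι → ℝ) (hW : ∀ i, Tendsto (fun n => w n i) 𝒰 (𝓝 (W i)))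
    (hβ : ∀ i, Tendsto (fun n => b n i) 𝒰 (𝓝 (β i))) (a' w' b' : N → κ → ℝ) {E : Set ℝ}
    (hE : MeasurableSet E) (h0 : volume E ≠ 0)
    (hv : ∀ j, ∀ t ∈ E, Tendsto (fun n => w' n j * t + b' n j) 𝒰 atBot)
    (h : ∀ t ∈ E, Tendsto (fun n => α n + ∑ i, a n i * Real.tanh (w n i * t + b n i) +
      ∑ j, a' n j * Real.tanh (w' n j * t + b' n j)) 𝒰 (𝓝 0)) (c : ℂ) :
    Tendsto (fun n => ∑ i with 1 + nodeExp (W i) (β i) c = 0, a n i / w n i) 𝒰 (𝓝 0) := by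
  obtain ⟨t₀, ht₀⟩ : E.Nonempty := by
    rw [Set.nonempty_iff_ne_empty]; rintro rfl; simp at h0
  -- Single saturated nodes may have unbounded frequency while sums over subsets remain bounded, so
  -- the splitting is by subsets and not by nodes.
  set 𝒮 : Finset (Finset κ) :=
    Finset.univ.filter fun S => ∃ l, Tendsto (fun n => ∑ j ∈ S, w' n j) 𝒰 (𝓝 l) with h𝒮
  set l : N → Finset ι × Finset κ → ℝ := fun n q => 2 * (∑ i ∈ q.1, w n i + ∑ j ∈ q.2, w' n j) with hl
  set co : N → Finset ι × Finset κ → ℂ := fun n q =>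
    ((α n : ℂ) + ∑ i, memSign q.1 i * a n i + ∑ j, memSign q.2 j * a' n j) with hco
  set d : N → Finset ι × Finset κ → ℂ := fun n q => co n q *
    Complex.exp (2 * ((∑ i ∈ q.1, b n i : ℝ) + (∑ j ∈ q.2, b' n j : ℝ))) with hd
  have hterm : ∀ n q (z : ℂ), d n q * Complex.exp (l n q * z) =
      co n q * ((∏ i ∈ q.1, nodeExp (w n i) (b n i) z) * ∏ j ∈ q.2, nodeExp (w' n j) (b' n j) z) := by
    intro n q z
    rw [prod_nodeExp, prod_nodeExp, nodeExp, nodeExp, ← Complex.exp_add, hd]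
    simp only
    rw [mul_assoc, ← Complex.exp_add, hl]
    congr 2
    push_cast
    ring
  have hsumW : ∀ R : Finset ι, Tendsto (fun n => ∑ i ∈ R, w n i) 𝒰 (𝓝 (∑ i ∈ R, W i)) :=
    fun R => tendsto_finsetSum _ fun i _ => hW i
  set B : Finset (Finset ι × Finset κ) := Finset.univ ×ˢ 𝒮 with hB
  set U : Finset (Finset ι × Finset κ) := Finset.univ ×ˢ 𝒮ᶜ with hU
  have hBU : B ∪ U = Finset.univ := by
    ext q; simp [hB, hU, Classical.em]
  have hdis : Disjoint B U := by
    rw [Finset.disjoint_left]; intro q hq hq'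
    simp only [hB, hU, Finset.mem_product, Finset.mem_compl] at hq hq'
    exact hq'.2 hq.2
  obtain ⟨L, hL1, hL⟩ : ∃ L, 1 ≤ L ∧ ∀ q ∈ B, ∀ᶠ n in (𝒰 : Filter N), |l n q| ≤ L := by
    have : ∀ q ∈ B, ∃ L, ∀ᶠ n in (𝒰 : Filter N), |l n q| ≤ L := by
      intro q hq
      have hq2 : q.2 ∈ 𝒮 := (Finset.mem_product.1 hq).2
      obtain ⟨l', hl'⟩ := (Finset.mem_filter.1 hq2).2
      have := (((hsumW q.1).add hl').const_mul 2).abs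
      exact ⟨_, (this.eventually_lt_const (lt_add_one _)).mono fun n hn => hn.le⟩
    choose! L hL using this
    refine ⟨1 + ∑ q ∈ B, |L q|, le_add_of_nonneg_right (Finset.sum_nonneg fun _ _ => abs_nonneg _),
      fun q hq => (hL q hq).mono fun n hn => hn.trans ?_⟩
    have := Finset.single_le_sum (f := fun q => |L q|) (fun _ _ => abs_nonneg _) hq
    linarith [le_abs_self (L q)]
  have hUl : ∀ q ∈ U, Tendsto (fun n => l n q) 𝒰 atTop ∨ Tendsto (fun n => l n q) 𝒰 atBot := by
    intro q hq
    have hq2 : q.2 ∉ 𝒮 := Finset.mem_compl.1 (Finset.mem_product.1 hq).2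
    have hno : ¬ ∃ l, Tendsto (fun n => ∑ j ∈ q.2, w' n j) 𝒰 (𝓝 l) := fun hex =>
      hq2 (Finset.mem_filter.2 ⟨Finset.mem_univ _, hex⟩)
    rcases tendsto_trichotomy 𝒰 (fun n => ∑ j ∈ q.2, w' n j) with h1 | h1 | h1
    · exact absurd h1 hno
    · exact Or.inl (((hsumW q.1).add_atTop h1).const_mul_atTop two_pos)
    · exact Or.inr (((hsumW q.1).add_atBot h1).const_mul_atBot two_pos)
  have hzero : ∀ t ∈ E, Tendsto (fun n => ∑ q ∈ B ∪ U, d n q * Complex.exp (l n q * (t : ℂ))) 𝒰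
      (𝓝 0) := by
    intro t ht
    refine (tendsto_sum_sign_zero 𝒰 α a w b W β hW hβ a' w' b' (fun j => hv j t ht)
      (h t ht)).congr fun n => ?_
    rw [hBU, Finset.sum_congr rfl fun q _ => hterm n q t]
  obtain ⟨ε, hε, hεb⟩ := bounded_part_tendsto_zero 𝒰 B l hL1 hL U d E hdis hUl hE h0 hzero
  obtain ⟨r, hr, hr1, hr2, hr3⟩ := exists_radius W β c
  have hlow : ∀ i, ∃ δ > 0, ∀ᶠ n in (𝒰 : Filter N), ∀ z ∈ Metric.sphere c r,
      δ ≤ ‖1 + nodeExp (w n i) (b n i) z‖ := by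
    intro i
    obtain ⟨δ, hδ, hev⟩ := eventually_le_norm_one_add_nodeExp (isCompact_sphere c r) (hr3 i)
    exact ⟨δ, hδ, ((hW i).prodMk_nhds (hβ i)).eventually hev⟩
  choose δ hδ hδb using hlow
  have hδb' : ∀ᶠ n in (𝒰 : Filter N), ∀ i, ∀ z ∈ Metric.sphere c r,
      δ i ≤ ‖1 + nodeExp (w n i) (b n i) z‖ := by
    rw [Filter.eventually_all]; exact hδb
  have hcirc : ∀ᶠ n in (𝒰 : Filter N), ∀ i,
      ∮ z in C(c, r), nodeFrac (nodeExp (w n i) (b n i) z) =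
        if 1 + nodeExp (W i) (β i) c = 0 then 2 * Real.pi * Complex.I / w n i else 0 := by
    rw [Filter.eventually_all]
    intro i
    by_cases hi : 1 + nodeExp (W i) (β i) c = 0
    · simp only [hi, if_true]
      have hWi : W i ≠ 0 := by
        intro h0
        apply one_add_nodeExp_ofReal_ne_zero 0 (β i) 0
        rw [← hi, h0]
        simp [nodeExp]
      have hp : Tendsto (fun n => ((W i * c + β i - b n i) / w n i : ℂ)) 𝒰 (𝓝 c) := by
        have h1 := (Complex.continuous_ofReal.tendsto _).comp (hβ i)
        have h2 := (Complex.continuous_ofReal.tendsto _).comp (hW i)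
        have hWc : (W i : ℂ) ≠ 0 := by exact_mod_cast hWi
        have := (tendsto_const_nhds (x := (W i * c + β i : ℂ)).sub h1).div h2 hWc
        rwa [add_sub_cancel_right, mul_div_cancel_left₀ _ hWc] at this
      have hrad : ∀ᶠ n in (𝒰 : Filter N), 2 * (|w n i| * r) < Real.pi :=
        (((hW i).abs.mul_const r).const_mul 2).eventually_lt_const (hr1 i hi)
      filter_upwards [hp.eventually (Metric.ball_mem_nhds c hr), hrad,
        (hW i).eventually_ne hWi] with n hn hn' hn''
      refine circleIntegral_nodeFrac hn'' hn ?_ hn'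
      have hwc : (w n i : ℂ) ≠ 0 := by exact_mod_cast hn''
      rw [← hi, nodeExp, nodeExp, mul_div_cancel₀ _ hwc, sub_add_cancel]
    · simp only [hi, if_false]
      obtain ⟨δ', hδ', hev⟩ :=
        eventually_le_norm_one_add_nodeExp (isCompact_closedBall c r) (hr2 i hi)
      filter_upwards [((hW i).prodMk_nhds (hβ i)).eventually hev] with n hn
      refine circleIntegral_eq_zero hr.le fun z hz => differentiableAt_nodeFrac fun h => ?_
      have := hn z hz
      rw [h, norm_zero] at this
      linarith
  have hq := eventually_norm_sum_le_half 𝒰 w' b' (fun j => hv j t₀ ht₀) 𝒮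
    (fun S hS => (Finset.mem_filter.1 hS).2) (‖c‖ + r)
  have hempty : ∅ ∈ 𝒮 := Finset.mem_filter.2 ⟨Finset.mem_univ _, 0, by simp⟩
  set K : ℝ := Real.exp (3 * L * (‖c‖ + r)) / ((∏ i, δ i) * (1 / 2)) with hK
  have hδprod : 0 < ∏ i, δ i := Finset.prod_pos fun i _ => hδ i
  rw [tendsto_zero_iff_norm_tendsto_zero]
  refine squeeze_zero' (Eventually.of_forall fun _ => norm_nonneg _) (g := fun n => r * (ε n * K)) ?_
    (by simpa using (hε.mul_const K).const_mul r)
  filter_upwards [hεb, hδb', hcirc, hq] with n hn1 hn2 hn3 hn4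
  set q : ℂ → ℂ := fun z => ∑ S ∈ 𝒮, ∏ j ∈ S, nodeExp (w' n j) (b' n j) z with hqdef
  set Y : ℂ → ℂ := fun z => ∑ S ∈ 𝒮, (∑ j, memSign S j * (a' n j : ℂ)) *
    ∏ j ∈ S, nodeExp (w' n j) (b' n j) z with hYdef
  have hprodd : ∀ S : Finset κ, Differentiable ℂ fun z => ∏ j ∈ S, nodeExp (w' n j) (b' n j) z := by
    intro S
    simp only [prod_nodeExp]
    exact differentiable_nodeExp _ _
  have hqd : Differentiable ℂ q := Differentiable.fun_sum fun S _ => hprodd S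
  have hYd : Differentiable ℂ Y := Differentiable.fun_sum fun S _ => (hprodd S).const_mul _
  have hball : ∀ z ∈ Metric.closedBall c r, ‖z‖ ≤ ‖c‖ + r := by
    intro z hz
    rw [mem_closedBall_iff_norm] at hz
    calc ‖z‖ = ‖c + (z - c)‖ := by ring_nf
      _ ≤ ‖c‖ + r := (norm_add_le _ _).trans (by gcongr)
  have hqlow : ∀ z ∈ Metric.closedBall c r, 1 / 2 ≤ ‖q z‖ := by
    intro z hz
    have h1 := hn4 z (hball z hz)
    have h2 : q z = 1 + ∑ S ∈ 𝒮.erase ∅, ∏ j ∈ S, nodeExp (w' n j) (b' n j) z := by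
      rw [hqdef]
      simp only
      rw [← Finset.add_sum_erase _ _ hempty, Finset.prod_empty]
    have h3 := norm_sub_le (q z) (∑ S ∈ 𝒮.erase ∅, ∏ j ∈ S, nodeExp (w' n j) (b' n j) z)
    rw [h2, add_sub_cancel_right, norm_one, ← h2] at h3
    linarith
  have hqne : ∀ z ∈ Metric.closedBall c r, q z ≠ 0 := by
    intro z hz h
    have := hqlow z hz
    rw [h, norm_zero] at this
    linarith
  -- The bounded part of the exponential sum is `(∏ (1 + x i)) * q * G`. Since `|q| ≥ 1 / 2` on the
  -- disc, the saturated nodes contribute only the holomorphic term `Y / q`, and the only possible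
  -- poles of `G` there are those of convergent nodes.
  set G : ℂ → ℂ := fun z => (α n : ℂ) + Y z / q z +
    ∑ i, (a n i : ℂ) * nodeFrac (nodeExp (w n i) (b n i) z) with hG
  have hne : ∀ i, ∀ z ∈ Metric.sphere c r, 1 + nodeExp (w n i) (b n i) z ≠ 0 := by
    intro i z hz h
    have := hn2 i z hz
    rw [h, norm_zero] at this
    linarith [hδ i]
  have hnodeint : ∀ i, CircleIntegrable
      (fun z => (a n i : ℂ) * nodeFrac (nodeExp (w n i) (b n i) z)) c r := fun i =>
    ContinuousOn.circleIntegrable hr.le fun z hz =>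
      ((differentiableAt_nodeFrac (hne i z hz)).const_mul _).continuousAt.continuousWithinAt
  have hhold : ∀ z ∈ Metric.closedBall c r,
      DifferentiableAt ℂ (fun z => (α n : ℂ) + Y z / q z) z := fun z hz =>
    ((hYd z).div (hqd z) (hqne z hz)).const_add _
  have hGint : ∮ z in C(c, r), G z = 2 * Real.pi * Complex.I *
      ((∑ i with 1 + nodeExp (W i) (β i) c = 0, a n i / w n i : ℝ) : ℂ) := by
    rw [hG, circleIntegral.integral_add (ContinuousOn.circleIntegrable hr.le fun z hz =>
        (hhold z (Metric.sphere_subset_closedBall hz)).continuousAt.continuousWithinAt)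
      (CircleIntegrable.fun_sum _ fun i _ => hnodeint i), circleIntegral_eq_zero hr.le hhold, zero_add,
      circleIntegral.integral_fun_sum fun i _ => hnodeint i, Finset.sum_filter]
    push_cast
    rw [Finset.mul_sum]
    refine Finset.sum_congr rfl fun i _ => ?_
    rw [circleIntegral.integral_const_mul, hn3 i]
    split_ifs <;> push_cast <;> ring
  have hGb : ∀ z ∈ Metric.sphere c r, ‖G z‖ ≤ ε n * K := by
    intro z hz
    have hz' := Metric.sphere_subset_closedBall hz
    have h1 := sum_sign_decomposition (α n : ℂ) (fun i => (a n i : ℂ))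
      (fun i => nodeExp (w n i) (b n i) z) (fun j => (a' n j : ℂ))
      (fun j => nodeExp (w' n j) (b' n j) z) 𝒮 (fun i => hne i z hz)
    have h2 : (∏ i, (1 + nodeExp (w n i) (b n i) z)) * q z * G z =
        ∑ s ∈ B, d n s * Complex.exp (l n s * z) := by
      rw [Finset.sum_congr rfl fun s _ => hterm n s z, h1, hG]
      have hY : Y z / q z * q z = Y z := div_mul_cancel₀ _ (hqne z hz')
      linear_combination (∏ i, (1 + nodeExp (w n i) (b n i) z)) * hY
    have h3 := norm_expSum_le hn1 0 z
    simp only [pow_zero, mul_one] at h3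
    rw [← h2, norm_mul, norm_mul, norm_prod] at h3
    have h4 : (∏ i, δ i) * (1 / 2) ≤ (∏ i, ‖1 + nodeExp (w n i) (b n i) z‖) * ‖q z‖ := by
      have := Finset.prod_le_prod (s := Finset.univ) (fun i _ => (hδ i).le) (fun i _ => hn2 i z hz)
      have := hqlow z hz'
      gcongr
    have hεn : 0 ≤ ε n := by
      have := (norm_nonneg _).trans (hn1 0)
      simpa using this
    rw [hK, ← mul_div_assoc, le_div_iff₀ (by positivity), mul_comm]
    calc _ ≤ (∏ i, ‖1 + nodeExp (w n i) (b n i) z‖) * ‖q z‖ * ‖G z‖ := by gcongr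
      _ ≤ ε n * Real.exp (3 * L * ‖z‖) := h3
      _ ≤ _ := by gcongr; exact hball z hz'
  have hfin := circleIntegral.norm_integral_le_of_norm_le_const hr.le hGb
  rw [hGint, norm_mul, norm_mul, norm_mul, Complex.norm_I, Complex.norm_real, Complex.norm_real,
    Complex.norm_ofNat, mul_one, Real.norm_eq_abs Real.pi, abs_of_pos Real.pi_pos] at hfin
  have h2π : 0 < 2 * Real.pi := by positivity
  rw [mul_assoc (2 * Real.pi)] at hfin
  exact le_of_mul_le_mul_left hfin h2π

end Residue

end LDR

namespace LDR

/-! ### Location of the poles of a hidden node -/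

lemma nodeExp_at_pole (W β ω γ : ℝ) :
    nodeExp W β (-γ + Real.pi / (2 * ω) * Complex.I) =
      Complex.exp ((2 * (β - W * γ) : ℝ) + (Real.pi * (W / ω) : ℝ) * Complex.I) := by
  rw [nodeExp]
  congr 1
  push_cast
  ring

/-- The modulus of the exponential fixes the real part of the pole. Its phase is `π * W / ω`, which
cannot reach `±π` when `|W| < ω`. Thus a node with slope `ω` has a pole that no node of smaller
slope shares. -/
lemma of_one_add_nodeExp_eq_zero {W β ω γ : ℝ} (hω : 0 < ω)
    (h : 1 + nodeExp W β (-γ + Real.pi / (2 * ω) * Complex.I) = 0) :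
    β = W * γ ∧ ω ≤ |W| := by
  have h1 : nodeExp W β (-γ + Real.pi / (2 * ω) * Complex.I) = -1 := by linear_combination h
  rw [nodeExp_at_pole] at h1
  have h2 := congrArg norm h1
  rw [Complex.norm_exp] at h2
  simp only [Complex.add_re, Complex.ofReal_re, Complex.mul_re, Complex.I_re, mul_zero,
    Complex.ofReal_im, Complex.I_im, mul_one, sub_self, add_zero, norm_neg, norm_one,
    Real.exp_eq_one_iff] at h2
  refine ⟨by linarith, ?_⟩
  rw [h2, Complex.ofReal_zero, zero_add] at h1
  have h3 := congrArg Complex.re h1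
  rw [Complex.exp_ofReal_mul_I_re, ← Real.cos_abs] at h3
  simp only [Complex.neg_re, Complex.one_re] at h3
  by_contra! hlt
  have h4 : |Real.pi * (W / ω)| < Real.pi := by
    rw [abs_mul, abs_div, abs_of_pos hω, abs_of_pos Real.pi_pos]
    have : |W| / ω < 1 := (div_lt_one hω).2 hlt
    nlinarith [Real.pi_pos]
  have h5 := Real.strictAntiOn_cos ⟨abs_nonneg _, h4.le⟩ ⟨Real.pi_pos.le, le_rfl⟩ h4
  rw [Real.cos_pi, h3] at h5
  exact lt_irrefl _ h5

lemma one_add_nodeExp_eq_zero {W β ω γ : ℝ} (hω : 0 < ω) (hW : |W| = ω) (hβ : β / W = γ) :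
    1 + nodeExp W β (-γ + Real.pi / (2 * ω) * Complex.I) = 0 := by
  have hW0 : W ≠ 0 := by rintro rfl; simp at hW; linarith
  rw [nodeExp_at_pole, ← hβ, mul_div_cancel₀ _ hW0, sub_self, mul_zero, Complex.ofReal_zero,
    zero_add]
  rcases abs_choice W with h | h
  · rw [← hW, h, div_self hW0, mul_one, Complex.exp_pi_mul_I]; ring
  · rw [← hW, h, div_neg, div_self hW0, mul_neg_one, Complex.ofReal_neg, neg_mul, Complex.exp_neg,
      Complex.exp_pi_mul_I]
    norm_num

/-- The pair `(|W|, β / W)` determines `(W, β)` up to sign, and a change of sign inverts the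
exponential, which fixes the value `-1`. -/
lemma nodeExp_eq_neg_one_congr {W β W' β' : ℝ} (h : |W| = |W'|) (h' : β / W = β' / W')
    (hW : W ≠ 0) (z : ℂ) (hz : 1 + nodeExp W β z = 0) : 1 + nodeExp W' β' z = 0 := by
  have hW' : W' ≠ 0 := by rw [← abs_pos, ← h]; exact abs_pos.2 hW
  rcases abs_eq_abs.1 h with h1 | h1
  · subst h1
    rw [div_left_inj' hW] at h'
    rwa [← h']
  · have h2 : β = -β' := by
      rw [h1, div_neg, ← neg_div, div_left_inj' hW'] at h'; linarith
    have h3 : nodeExp W' β' z = (nodeExp W β z)⁻¹ := by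
      rw [nodeExp, nodeExp, ← Complex.exp_neg, h1, h2]; congr 1; push_cast; ring
    have h4 : nodeExp W β z = -1 := by linear_combination hz
    rw [h3, h4]; norm_num

/-! ### Saturation of divergent nodes on a smaller set -/

section Saturation

variable {N : Type*}

lemma measure_inter_ordConnected {E : Set ℝ} (h0 : volume E ≠ 0) {A B C : Set ℝ}
    (hE : E ⊆ A ∪ B ∪ C) (hC : C.Subsingleton) : volume (E ∩ A) ≠ 0 ∨ volume (E ∩ B) ≠ 0 := by
  by_contra! h
  apply h0
  refine measure_mono_null (t := (E ∩ A) ∪ (E ∩ B) ∪ C) ?_ ?_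
  · intro t ht
    rcases hE ht with (h | h) | h
    · exact Or.inl (Or.inl ⟨ht, h⟩)
    · exact Or.inl (Or.inr ⟨ht, h⟩)
    · exact Or.inr h
  · exact measure_union_null (measure_union_null h.1 h.2) (hC.measure_zero _)

/-- Finite limits of the affine forms at two points would make `w` and `b` converge. Hence, with at
most one exception, every `t` gives a limit `±∞`, and one of the two signs occurs on a set of
positive measure. The sets concerned are intervals, hence measurable. -/
lemma exists_saturation (𝒰 : Ultrafilter N) (w b : N → ℝ)
    (hn : ¬ ∃ W β, Tendsto w 𝒰 (𝓝 W) ∧ Tendsto b 𝒰 (𝓝 β)) {E : Set ℝ} (hE : MeasurableSet E)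
    (h0 : volume E ≠ 0) :
    ∃ s : ℝ, s * s = 1 ∧ ∃ E' ⊆ E, MeasurableSet E' ∧ volume E' ≠ 0 ∧
      ∀ t ∈ E', Tendsto (fun n => s * w n * t + s * b n) 𝒰 atBot := by
  set A : ℝ → Set ℝ := fun s => {t | Tendsto (fun n => s * w n * t + s * b n) 𝒰 atBot} with hA
  have hAoc : ∀ s, (A s).OrdConnected := by
    intro s
    refine ⟨fun x hx y hy t ht => ?_⟩
    have hmax : Tendsto (fun n => max (s * w n * x + s * b n) (s * w n * y + s * b n)) 𝒰 atBot := by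
      rw [tendsto_atBot]
      intro c
      filter_upwards [tendsto_atBot.1 hx c, tendsto_atBot.1 hy c] with n h1 h2
      exact max_le h1 h2
    refine tendsto_atBot_mono (fun n => ?_) hmax
    rcases le_total 0 (s * w n) with h | h
    · exact le_max_of_le_right (by nlinarith [ht.2])
    · exact le_max_of_le_left (by nlinarith [ht.1])
  have hC : {t | ∃ l, Tendsto (fun n => w n * t + b n) 𝒰 (𝓝 l)}.Subsingleton := by
    rintro x ⟨l, hl⟩ y ⟨l', hl'⟩
    by_contra hne
    apply hn
    have hxy : x - y ≠ 0 := sub_ne_zero.2 hne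
    have hW : Tendsto w 𝒰 (𝓝 ((l - l') / (x - y))) := by
      refine ((hl.sub hl').div_const (x - y)).congr fun n => ?_
      field_simp; ring
    refine ⟨_, l - (l - l') / (x - y) * x, hW, ?_⟩
    exact (hl.sub (hW.mul_const x)).congr fun n => by ring
  have hcover : E ⊆ A 1 ∪ A (-1) ∪ {t | ∃ l, Tendsto (fun n => w n * t + b n) 𝒰 (𝓝 l)} := by
    intro t _
    rcases tendsto_trichotomy 𝒰 (fun n => w n * t + b n) with h | h | h
    · exact Or.inr h
    · refine Or.inl (Or.inr ?_)
      exact (tendsto_neg_atTop_atBot.comp h).congr fun n => by simp only [Function.comp]; ring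
    · refine Or.inl (Or.inl ?_)
      exact h.congr fun n => by ring
  rcases measure_inter_ordConnected h0 hcover hC with h | h
  · exact ⟨1, by norm_num, _, Set.inter_subset_left, hE.inter (hAoc 1).measurableSet, h,
      fun t ht => ht.2⟩
  · exact ⟨-1, by norm_num, _, Set.inter_subset_left, hE.inter (hAoc (-1)).measurableSet, h,
      fun t ht => ht.2⟩

lemma exists_saturation_finset (𝒰 : Ultrafilter N) {κ : Type*} [DecidableEq κ] (w b : N → κ → ℝ)
    (hn : ∀ j, ¬ ∃ W β, Tendsto (fun n => w n j) 𝒰 (𝓝 W) ∧ Tendsto (fun n => b n j) 𝒰 (𝓝 β))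
    {E : Set ℝ} (hE : MeasurableSet E) (h0 : volume E ≠ 0) (T : Finset κ) :
    ∃ s : κ → ℝ, (∀ j, s j * s j = 1) ∧ ∃ E' ⊆ E, MeasurableSet E' ∧ volume E' ≠ 0 ∧
      ∀ j ∈ T, ∀ t ∈ E', Tendsto (fun n => s j * w n j * t + s j * b n j) 𝒰 atBot := by
  induction T using Finset.induction_on with
  | empty => exact ⟨fun _ => 1, fun _ => by norm_num, E, subset_rfl, hE, h0, by simp⟩
  | insert i T hi ih =>
    obtain ⟨s, hs, E', hE'E, hE', h0', h⟩ := ih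
    obtain ⟨s', hs', E'', hE''E, hE'', h0'', h'⟩ :=
      exists_saturation 𝒰 (fun n => w n i) (fun n => b n i) (hn i) hE' h0'
    refine ⟨Function.update s i s', fun j => ?_, E'', hE''E.trans hE'E, hE'', h0'', fun j hj t ht => ?_⟩
    · by_cases hj : j = i
      · subst hj; simpa using hs'
      · simpa [hj] using hs j
    · rcases Finset.mem_insert.1 hj with rfl | hjT
      · simpa using h' t ht
      · have hji : j ≠ i := by rintro rfl; exact hi hjT
        simpa [hji] using h j hjT t (hE''E ht)

end Saturation

/-! ### Separating the residues of different limit nodes -/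

section ClassResidue

variable {N : Type*} {ι : Type*} [Fintype ι]

lemma mul_tanh_mul {s : ℝ} (hs : s * s = 1) (u : ℝ) : s * Real.tanh (s * u) = Real.tanh u := by
  rcases mul_self_eq_one_iff.1 hs with rfl | rfl
  · simp
  · simp [Real.tanh_neg]

open Classical in
/-- The residues of the convergent nodes with a common limit, up to sign, cancel in the limit. -/
lemma tendsto_key_residue_zero (𝒰 : Ultrafilter N) (f : N → ι → ℝ) (W β : ι → ℝ)
    (hres : ∀ c : ℂ, Tendsto (fun n => ∑ i with 1 + nodeExp (W i) (β i) c = 0, f n i) 𝒰 (𝓝 0))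
    (v : ℝ × ℝ) (hv : 0 < v.1) :
    Tendsto (fun n => ∑ i with (|W i|, β i / W i) = v, f n i) 𝒰 (𝓝 0) := by
  set key : ι → ℝ × ℝ := fun i => (|W i|, β i / W i) with hkey
  set bad : Finset (ℝ × ℝ) := (Finset.univ.image key).filter fun v => 0 < v.1 ∧
    ¬ Tendsto (fun n => ∑ i with key i = v, f n i) 𝒰 (𝓝 0) with hbad
  have hmem : ∀ v : ℝ × ℝ, 0 < v.1 → v ∉ bad →
      Tendsto (fun n => ∑ i with key i = v, f n i) 𝒰 (𝓝 0) := by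
    intro v hv hvb
    by_contra hcon
    apply hvb
    rw [hbad, Finset.mem_filter]
    refine ⟨?_, hv, hcon⟩
    by_contra him
    apply hcon
    have : Finset.univ.filter (fun i => key i = v) = ∅ := by
      ext i
      simp only [Finset.mem_filter, Finset.mem_univ, true_and, Finset.notMem_empty, iff_false]
      rintro rfl
      exact him (Finset.mem_image_of_mem _ (Finset.mem_univ _))
    simp [this]
  suffices hempty : bad = ∅ from hmem v hv (by simp [hempty])
  by_contra hne
  -- Descending induction on the slope: at the pole nearest to the real axis of the class `v`, the
  -- only other nodes with a pole have larger slope, and their classes cancel by maximality.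
  obtain ⟨v, hvbad, hmax⟩ := Finset.exists_max_image bad (fun v => v.1)
    (Finset.nonempty_iff_ne_empty.2 hne)
  obtain ⟨-, hv, hnot⟩ := Finset.mem_filter.1 hvbad
  apply hnot
  set c : ℂ := -v.2 + Real.pi / (2 * v.1) * Complex.I with hc
  set Z : Finset ι := Finset.univ.filter fun i => 1 + nodeExp (W i) (β i) c = 0 with hZ
  have hvZ : Finset.univ.filter (fun i => key i = v) = Z.filter fun i => key i = v := by
    ext i
    simp only [hZ, Finset.mem_filter, Finset.mem_univ, true_and, iff_and_self]
    intro hi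
    exact one_add_nodeExp_eq_zero hv (congrArg Prod.fst hi) (congrArg Prod.snd hi)
  have hrest : Tendsto (fun n => ∑ i ∈ Z.filter (fun i => ¬ key i = v), f n i) 𝒰 (𝓝 0) := by
    have hfib : ∀ n, ∑ i ∈ Z.filter (fun i => ¬ key i = v), f n i =
        ∑ v' ∈ (Z.filter fun i => ¬ key i = v).image key,
          ∑ i ∈ (Z.filter fun i => ¬ key i = v) with key i = v', f n i := fun n =>
      (Finset.sum_fiberwise_of_maps_to (fun i hi => Finset.mem_image_of_mem _ hi) _).symm
    simp only [hfib]
    rw [← Finset.sum_const_zero (s := (Z.filter fun i => ¬ key i = v).image key)]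
    refine tendsto_finsetSum _ fun v' hv' => ?_
    obtain ⟨i₀, hi₀, rfl⟩ := Finset.mem_image.1 hv'
    simp only [hZ, Finset.mem_filter, Finset.mem_univ, true_and] at hi₀
    obtain ⟨hβ, hω⟩ := of_one_add_nodeExp_eq_zero hv hi₀.1
    have hWpos : 0 < |W i₀| := hv.trans_le hω
    have hW0 : W i₀ ≠ 0 := abs_pos.1 hWpos
    have hnb : key i₀ ∉ bad := by
      intro hb
      have h1 : |W i₀| = v.1 := le_antisymm (hmax _ hb) hω
      apply hi₀.2
      refine Prod.ext h1 ?_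
      rw [hkey]
      simp only
      rw [hβ, mul_div_cancel_left₀ _ hW0]
    refine (hmem _ hWpos hnb).congr fun n => Finset.sum_congr ?_ fun _ _ => rfl
    ext i
    simp only [hZ, Finset.mem_filter, Finset.mem_univ, true_and]
    constructor
    · intro hi
      refine ⟨⟨?_, hi ▸ hi₀.2⟩, hi⟩
      exact nodeExp_eq_neg_one_congr (congrArg Prod.fst hi).symm (congrArg Prod.snd hi).symm
        hW0 c hi₀.1
    · exact fun hi => hi.2
  have h1 := (hres c).sub hrest
  rw [sub_zero] at h1
  refine h1.congr fun n => ?_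
  rw [hvZ, ← Finset.sum_filter_add_sum_filter_not Z (fun i => key i = v)]
  ring

/-- `w` and `b` converge to `±(W, β)`. -/
def ConvergesUpToSign (𝒰 : Ultrafilter N) (w b : N → ℝ) (W β : ℝ) : Prop :=
  ∃ W' β', Tendsto w 𝒰 (𝓝 W') ∧ Tendsto b 𝒰 (𝓝 β') ∧ |W'| = |W| ∧ β' / W' = β / W

open Classical in
/-- If a network output tends to zero on a set of positive measure, then the residues of the hidden
nodes with a given nonconstant limit cancel in the limit. -/
theorem tendsto_class_residue_zero (𝒰 : Ultrafilter N) (α : N → ℝ) (a w b : N → ι → ℝ) {E : Set ℝ}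
    (hE : MeasurableSet E) (h0 : volume E ≠ 0)
    (h : ∀ t ∈ E, Tendsto (fun n => α n + ∑ i, a n i * Real.tanh (w n i * t + b n i)) 𝒰 (𝓝 0))
    {W β : ℝ} (hW : W ≠ 0) :
    Tendsto (fun n => ∑ i with ConvergesUpToSign 𝒰 (fun n => w n i) (fun n => b n i) W β,
      a n i / w n i) 𝒰 (𝓝 0) := by
  set C : ι → Prop := fun i =>
    ∃ W β, Tendsto (fun n => w n i) 𝒰 (𝓝 W) ∧ Tendsto (fun n => b n i) 𝒰 (𝓝 β) with hC
  have hCi : ∀ i : {i // C i}, C i.1 := fun i => i.2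
  choose W' β' hW' hβ' using hCi
  -- As `tanh` is odd, the signs `s j` can be moved into the outgoing weights, so all divergent
  -- nodes saturate at `-∞`.
  obtain ⟨s, hs, E', hE'E, hE', h0', hsat⟩ := exists_saturation_finset 𝒰
    (fun n (j : {i // ¬ C i}) => w n j) (fun n j => b n j) (fun j => j.2) hE h0 Finset.univ
  have hres := tendsto_residue_sum_zero 𝒰 α (fun n (i : {i // C i}) => a n i) (fun n i => w n i)
    (fun n i => b n i) W' β' hW' hβ' (fun n (j : {i // ¬ C i}) => s j * a n j)
    (fun n j => s j * w n j) (fun n j => s j * b n j) hE' h0'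
    (fun j t ht => hsat j (Finset.mem_univ _) t ht) (fun t ht => by
      refine (h t (hE'E ht)).congr fun n => ?_
      rw [add_assoc]
      congr 1
      rw [← Fintype.sum_subtype_add_sum_subtype C]
      congr 1
      refine Finset.sum_congr rfl fun j _ => ?_
      rw [show s j * w n j * t + s j * b n j = s j * (w n j * t + b n j) by ring,
        ← mul_tanh_mul (hs j) (w n j * t + b n j)]
      ring)
  have hkey := tendsto_key_residue_zero 𝒰 (fun n (i : {i // C i}) => a n i / w n i) W' β' hres
    (|W|, β / W) (abs_pos.2 hW)
  refine hkey.congr fun n => ?_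
  rw [Finset.sum_filter, Finset.sum_filter, ← Fintype.sum_subtype_add_sum_subtype C]
  have hz : ∑ j : {i // ¬ C i}, (if ConvergesUpToSign 𝒰 (fun n => w n j) (fun n => b n j) W β
      then a n j / w n j else 0) = 0 := by
    refine Finset.sum_eq_zero fun j _ => if_neg ?_
    rintro ⟨W₁, β₁, h1, h2, -⟩
    exact j.2 ⟨W₁, β₁, h1, h2⟩
  rw [hz, add_zero]
  refine Finset.sum_congr rfl fun i _ => ?_
  congr 1
  rw [Prod.mk.injEq, eq_iff_iff]
  constructor
  · rintro ⟨h1, h2⟩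
    exact ⟨_, _, hW' i, hβ' i, h1, h2⟩
  · rintro ⟨W₁, β₁, h1, h2, h3, h4⟩
    rw [tendsto_nhds_unique (hW' i) h1, tendsto_nhds_unique (hβ' i) h2]
    exact ⟨h3, h4⟩

end ClassResidue

end LDR

namespace LDR

lemma exists_sign {W β W' β' : ℝ} (hW : W ≠ 0) (h : |W'| = |W|) (h' : β' / W' = β / W) :
    ∃ s : ℤˣ, W' = ((s : ℤ) : ℝ) * W ∧ β' = ((s : ℤ) : ℝ) * β := by
  have hW' : W' ≠ 0 := by rw [← abs_pos, h]; exact abs_pos.2 hW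
  rw [div_eq_div_iff hW' hW] at h'
  rcases abs_eq_abs.1 h with h1 | h1
  · refine ⟨1, by simpa using h1, ?_⟩
    subst h1
    simpa using mul_right_cancel₀ hW h'
  · refine ⟨-1, by simpa using h1, ?_⟩
    subst h1
    have : β' * W = -β * W := by linarith
    simpa using mul_right_cancel₀ hW this

/-! ### Matching nodes with the nodes of the limit network -/

section Matching

variable {N : Type*} {ι : Type*} [Fintype ι]

open Classical in
/-- If networks converge on a set of positive measure to an irreducible network of the same size,
then their weights converge, up to a permutation and signs. -/
theorem exists_matching (𝒰 : Ultrafilter N) (α : N → ℝ) (a w b : N → ι → ℝ) (α₀ : ℝ)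
    (A W B : ι → ℝ) (hA : ∀ i, A i ≠ 0) (hW : ∀ i, W i ≠ 0)
    (hkey : Function.Injective fun i => (|W i|, B i / W i)) {E : Set ℝ}
    (hE : MeasurableSet E) (h0 : volume E ≠ 0)
    (h : ∀ t ∈ E, Tendsto (fun n => α n + ∑ i, a n i * Real.tanh (w n i * t + b n i)) 𝒰
      (𝓝 (α₀ + ∑ i, A i * Real.tanh (W i * t + B i)))) :
    ∃ (σ : Equiv.Perm ι) (s : ι → ℤˣ), ∀ i,
      Tendsto (fun n => a n i) 𝒰 (𝓝 (((s i : ℤ) : ℝ) * A (σ i))) ∧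
      Tendsto (fun n => w n i) 𝒰 (𝓝 (((s i : ℤ) : ℝ) * W (σ i))) ∧
      Tendsto (fun n => b n i) 𝒰 (𝓝 (((s i : ℤ) : ℝ) * B (σ i))) := by
  have hres : ∀ j, Tendsto (fun n => ∑ i with ConvergesUpToSign 𝒰 (fun n => w n i)
      (fun n => b n i) (W j) (B j), a n i / w n i) 𝒰 (𝓝 (A j / W j)) := by
    intro j
    -- Applied to the difference with the limit network, whose nodes form a second, constant copy of
    -- `ι`. By `hkey` only the node `j` of that copy lies in the class of `j`.
    have h1 := tendsto_class_residue_zero 𝒰 (fun n => α n - α₀)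
      (fun n => Sum.elim (a n) (fun i => -A i)) (fun n => Sum.elim (w n) W)
      (fun n => Sum.elim (b n) B) hE h0 (fun t ht => by
        have h2 := (h t ht).sub_const (α₀ + ∑ i, A i * Real.tanh (W i * t + B i))
        rw [sub_self] at h2
        refine h2.congr fun n => ?_
        rw [Fintype.sum_sum_type]
        simp only [Sum.elim_inl, Sum.elim_inr, neg_mul, Finset.sum_neg_distrib]
        ring) (W := W j) (β := B j) (hW j)
    have h3 := h1.add_const (A j / W j)
    rw [zero_add] at h3
    refine h3.congr fun n => ?_
    rw [Finset.sum_filter, Finset.sum_filter, Fintype.sum_sum_type]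
    simp only [Sum.elim_inl, Sum.elim_inr]
    have h4 : ∑ i, (if ConvergesUpToSign 𝒰 (fun _ : N => W i) (fun _ => B i) (W j) (B j)
        then -A i / W i else 0) = -A j / W j := by
      rw [Finset.sum_eq_single j]
      · exact if_pos ⟨_, _, tendsto_const_nhds, tendsto_const_nhds, rfl, rfl⟩
      · intro i _ hij
        refine if_neg ?_
        rintro ⟨W', β', h5, h6, h7, h8⟩
        rw [← tendsto_nhds_unique tendsto_const_nhds h5] at h7 h8
        rw [← tendsto_nhds_unique tendsto_const_nhds h6] at h8
        exact hij (hkey (Prod.ext h7 h8))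
      · simp
    have h5 : ∀ u v : ℝ, v = -A j / W j → u + v + A j / W j = u := by
      rintro u v rfl; ring
    exact h5 _ _ h4
  have hne : ∀ j, ∃ i, ConvergesUpToSign 𝒰 (fun n => w n i) (fun n => b n i) (W j) (B j) := by
    intro j
    by_contra! hno
    have h1 := hres j
    simp only [hno, Finset.filter_false, Finset.sum_empty] at h1
    exact div_ne_zero (hA j) (hW j) (tendsto_nhds_unique h1 tendsto_const_nhds)
  choose τ hτ using hne
  have huniq : ∀ i j j', ConvergesUpToSign 𝒰 (fun n => w n i) (fun n => b n i) (W j) (B j) →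
      ConvergesUpToSign 𝒰 (fun n => w n i) (fun n => b n i) (W j') (B j') → j = j' := by
    rintro i j j' ⟨W₁, β₁, h1, h2, h3, h4⟩ ⟨W₂, β₂, h5, h6, h7, h8⟩
    rw [← tendsto_nhds_unique h1 h5] at h7 h8
    rw [← tendsto_nhds_unique h2 h6] at h8
    exact hkey (Prod.ext (h3.symm.trans h7) (h4.symm.trans h8))
  -- Equality of the numbers of nodes enters here: injectivity of `τ` makes it bijective, so each
  -- class contains exactly one node.
  have hinj : Function.Injective τ := fun j j' hjj => huniq (τ j) j j' (hτ j) (hjj ▸ hτ j')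
  have hbij := Finite.injective_iff_bijective.1 hinj
  set e := Equiv.ofBijective τ hbij with he
  have hei : ∀ i, τ (e.symm i) = i := fun i => e.apply_symm_apply i
  have hsingle : ∀ j, Tendsto (fun n => a n (τ j) / w n (τ j)) 𝒰 (𝓝 (A j / W j)) := by
    intro j
    refine (hres j).congr fun n => ?_
    have : (Finset.univ.filter fun i => ConvergesUpToSign 𝒰 (fun n => w n i) (fun n => b n i)
        (W j) (B j)) = {τ j} := by
      ext i
      simp only [Finset.mem_filter, Finset.mem_univ, true_and, Finset.mem_singleton]
      constructor
      · intro hi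
        rw [← hei i] at hi
        rw [← huniq _ _ _ (hτ (e.symm i)) hi, hei]
      · rintro rfl; exact hτ j
    rw [this, Finset.sum_singleton]
  have hmain : ∀ i, ∃ s : ℤˣ,
      Tendsto (fun n => a n i) 𝒰 (𝓝 (((s : ℤ) : ℝ) * A (e.symm i))) ∧
      Tendsto (fun n => w n i) 𝒰 (𝓝 (((s : ℤ) : ℝ) * W (e.symm i))) ∧
      Tendsto (fun n => b n i) 𝒰 (𝓝 (((s : ℤ) : ℝ) * B (e.symm i))) := by
    intro i
    obtain ⟨W', β', h1, h2, h3, h4⟩ := hτ (e.symm i)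
    have h5 := hsingle (e.symm i)
    rw [hei] at h1 h2 h5
    obtain ⟨s, rfl, rfl⟩ := exists_sign (hW _) h3 h4
    refine ⟨s, ?_, h1, h2⟩
    have hne : ((s : ℤ) : ℝ) * W (e.symm i) ≠ 0 := by
      rw [← abs_pos, h3]; exact abs_pos.2 (hW _)
    have h6 := h5.mul h1
    -- The outgoing weight is recovered as the residue times the slope, both of which converge.
    rw [show A (e.symm i) / W (e.symm i) * (((s : ℤ) : ℝ) * W (e.symm i)) =
      ((s : ℤ) : ℝ) * A (e.symm i) by field_simp [hW]] at h6
    refine h6.congr' ?_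
    filter_upwards [h1.eventually_ne hne] with n hn
    exact div_mul_cancel₀ _ hn
  choose s hs using hmain
  exact ⟨e.symm, s, hs⟩

end Matching

/-! ### Linear independence of the derivatives of a network -/

section Independence

variable {ι : Type*} [Fintype ι]

lemma one_sub_tanh_sq (w b t : ℝ) :
    (((1 - Real.tanh (w * t + b) ^ 2 : ℝ)) : ℂ) * (1 + nodeExp w b t) ^ 2 =
      4 * nodeExp w b t := by
  rw [Complex.ofReal_sub, Complex.ofReal_pow, Complex.ofReal_one, ← nodeFrac_nodeExp_ofReal,
    nodeFrac]
  field_simp [one_add_nodeExp_ofReal_ne_zero w b t]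
  ring

lemma tanh_mul_one_add (w b t : ℝ) :
    ((Real.tanh (w * t + b) : ℝ) : ℂ) * (1 + nodeExp w b t) = nodeExp w b t - 1 := by
  rw [← nodeFrac_nodeExp_ofReal, nodeFrac, div_mul_cancel₀ _ (one_add_nodeExp_ofReal_ne_zero w b t)]

open Classical in
/-- The functions `1`, `tanh u`, `1 - tanh² u` and `t (1 - tanh² u)`, for affine forms `u` that are
nonconstant and distinct up to sign, are linearly independent. -/
theorem tanh_independent (α : ℝ) (h p q W B : ι → ℝ) (hW : ∀ i, W i ≠ 0)
    (hkey : Function.Injective fun i => (|W i|, B i / W i)) {E : Set ℝ} (h0 : volume E ≠ 0)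
    (hzero : ∀ t ∈ E, α + ∑ i, (h i * Real.tanh (W i * t + B i) +
      (p i * t + q i) * (1 - Real.tanh (W i * t + B i) ^ 2)) = 0) (i : ι) :
    h i = 0 ∧ p i = 0 ∧ q i = 0 := by
  set S : Finset ι := Finset.univ.filter fun i => ¬ (h i = 0 ∧ p i = 0 ∧ q i = 0) with hS
  suffices hempty : S = ∅ by
    by_contra hcon
    have : i ∈ S := Finset.mem_filter.2 ⟨Finset.mem_univ _, hcon⟩
    simp [hempty] at this
  by_contra hne
  -- Among the nodes with a nonzero coefficient, the one of largest slope has a pole `c` shared by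
  -- no other.
  obtain ⟨o, hoS, hmax⟩ := Finset.exists_max_image S (fun i => |W i|)
    (Finset.nonempty_iff_ne_empty.2 hne)
  set x : ι → ℂ → ℂ := fun i z => nodeExp (W i) (B i) z with hx
  have hxd : ∀ i, Differentiable ℂ (x i) := fun i => differentiable_nodeExp _ _
  set P : ℂ → ℂ := fun z => ∏ j ∈ S.erase o, (1 + x j z) ^ 2 with hP
  set R : ℂ → ℂ := fun z => α * P z + ∑ i ∈ S.erase o, (h i * ((x i z - 1) * (1 + x i z)) +
    (p i * z + q i) * (4 * x i z)) * ∏ j ∈ (S.erase o).erase i, (1 + x j z) ^ 2 with hR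
  have hPd : Differentiable ℂ P := by
    refine Differentiable.fun_finsetProd fun j _ => ?_
    exact ((hxd j).const_add 1).pow 2
  have hRd : Differentiable ℂ R := by
    refine (hPd.const_mul _).add (Differentiable.fun_sum fun i _ => ?_)
    refine Differentiable.mul ?_ (Differentiable.fun_finsetProd fun j _ => ((hxd j).const_add 1).pow 2)
    exact ((((hxd i).sub_const 1).mul ((hxd i).const_add 1)).const_mul _).add
      (((differentiable_id.const_mul _).add_const _).mul ((hxd i).const_mul 4))
  have hreal : ∀ t ∈ E, P t * (h o * Real.tanh (W o * t + B o) +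
      (p o * t + q o) * (1 - Real.tanh (W o * t + B o) ^ 2) : ℝ) + R t = 0 := by
    intro t ht
    have h1 := hzero t ht
    rw [← Finset.sum_filter_add_sum_filter_not Finset.univ
      (fun i => ¬ (h i = 0 ∧ p i = 0 ∧ q i = 0))] at h1
    have h2 : ∑ i with ¬ ¬ (h i = 0 ∧ p i = 0 ∧ q i = 0), (h i * Real.tanh (W i * t + B i) +
        (p i * t + q i) * (1 - Real.tanh (W i * t + B i) ^ 2)) = 0 := by
      refine Finset.sum_eq_zero fun i hi => ?_
      obtain ⟨e1, e2, e3⟩ := not_not.1 (Finset.mem_filter.1 hi).2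
      rw [e1, e2, e3]; ring
    rw [h2, add_zero, ← hS, ← Finset.add_sum_erase _ _ hoS] at h1
    have h3 : R t = P t * ((α + ∑ i ∈ S.erase o, (h i * Real.tanh (W i * t + B i) +
        (p i * t + q i) * (1 - Real.tanh (W i * t + B i) ^ 2)) : ℝ) : ℂ) := by
      rw [hR]
      simp only
      rw [Complex.ofReal_add, mul_add, mul_comm (α : ℂ)]
      congr 1
      rw [Complex.ofReal_sum, Finset.mul_sum]
      refine Finset.sum_congr rfl fun i hi => ?_
      rw [hP]
      simp only
      rw [← Finset.mul_prod_erase _ _ hi]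
      have e1 := tanh_mul_one_add (W i) (B i) t
      have e2 := one_sub_tanh_sq (W i) (B i) t
      rw [Complex.ofReal_add, Complex.ofReal_mul, Complex.ofReal_mul, Complex.ofReal_add,
        Complex.ofReal_mul, hx]
      simp only
      rw [← e1, ← e2]
      ring
    rw [h3, ← mul_add, ← Complex.ofReal_add]
    have : h o * Real.tanh (W o * t + B o) + (p o * t + q o) * (1 - Real.tanh (W o * t + B o) ^ 2) +
        (α + ∑ i ∈ S.erase o, (h i * Real.tanh (W i * t + B i) +
        (p i * t + q i) * (1 - Real.tanh (W i * t + B i) ^ 2))) = 0 := by linarith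
    rw [this]; simp
  set ω := |W o| with hω
  set γ := B o / W o with hγ
  have hωpos : 0 < ω := abs_pos.2 (hW o)
  set c : ℂ := -γ + Real.pi / (2 * ω) * Complex.I with hc
  have hxo : 1 + x o c = 0 := one_add_nodeExp_eq_zero hωpos rfl rfl
  have hxo' : x o c = -1 := by linear_combination hxo
  have hPc : P c ≠ 0 := by
    refine Finset.prod_ne_zero_iff.2 fun j hj => pow_ne_zero 2 fun hjc => ?_
    obtain ⟨e1, e2⟩ := of_one_add_nodeExp_eq_zero hωpos hjc
    obtain ⟨hjo, hjS⟩ := Finset.mem_erase.1 hj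
    apply hjo
    refine hkey (Prod.ext (le_antisymm (hmax j hjS) e2) ?_)
    simp only
    rw [e1, mul_div_cancel_left₀ _ (hW j)]
  -- With denominators cleared the relation is an entire identity. At `c` only the double pole
  -- survives and gives `p o * c + q o = 0`; as `c` is not real, both coefficients vanish.
  have hF1 : ∀ z, P z * (h o * ((x o z - 1) * (1 + x o z)) + (p o * z + q o) * (4 * x o z)) +
      (1 + x o z) ^ 2 * R z = 0 := by
    refine eq_zero_of_forall_mem_eq_zero ?_ h0 fun t ht => ?_
    · refine (hPd.mul ?_).add ((((hxd o).const_add 1).pow 2).mul hRd)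
      exact ((((hxd o).sub_const 1).mul ((hxd o).const_add 1)).const_mul _).add
        (((differentiable_id.const_mul _).add_const _).mul ((hxd o).const_mul 4))
    · have e1 := tanh_mul_one_add (W o) (B o) t
      have e2 := one_sub_tanh_sq (W o) (B o) t
      have e3 := hreal t ht
      rw [Complex.ofReal_add, Complex.ofReal_mul, Complex.ofReal_mul, Complex.ofReal_add,
        Complex.ofReal_mul] at e3
      simp only [hx]
      rw [← e1, ← e2]
      linear_combination (1 + nodeExp (W o) (B o) t) ^ 2 * e3
  have h1 := hF1 c
  rw [hxo, hxo'] at h1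
  have h2 : (p o : ℂ) * c + q o = 0 := by
    have : P c * ((p o * c + q o) * (-4)) = 0 := by linear_combination h1
    simpa [hPc] using this
  have hcim : c.im = Real.pi / (2 * ω) := by
    have : c = ((-γ : ℝ) : ℂ) + ((Real.pi / (2 * ω) : ℝ) : ℂ) * Complex.I := by
      rw [hc]; push_cast; ring
    rw [this, Complex.add_im, Complex.ofReal_im, Complex.im_ofReal_mul, Complex.I_im]
    ring
  have hp : p o = 0 := by
    have h3 := congrArg Complex.im h2
    have hpos : Real.pi / (2 * ω) ≠ 0 := by positivity
    simpa [hcim, hpos] using h3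
  have hq : q o = 0 := by simpa [hp] using h2
  -- With the double pole gone, one factor `1 + x o z` fewer is needed, and the simple pole at `c`
  -- gives `h o = 0`.
  have hF2 : ∀ z, P z * (h o * (x o z - 1)) + (1 + x o z) * R z = 0 := by
    refine eq_zero_of_forall_mem_eq_zero ?_ h0 fun t ht => ?_
    · exact (hPd.mul (((hxd o).sub_const 1).const_mul _)).add (((hxd o).const_add 1).mul hRd)
    · have e1 := tanh_mul_one_add (W o) (B o) t
      have e3 := hreal t ht
      rw [hp, hq, zero_mul, zero_add, zero_mul, add_zero, Complex.ofReal_mul] at e3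
      simp only [hx]
      rw [← e1]
      linear_combination (1 + nodeExp (W o) (B o) t) * e3
  have h4 := hF2 c
  rw [hxo, hxo'] at h4
  have h5 : h o = 0 := by
    have : P c * (h o * (-2)) = 0 := by linear_combination h4
    simpa [hPc] using this
  exact (Finset.mem_filter.1 hoS).2 ⟨h5, hp, hq⟩

end Independence

end LDR

namespace LDR

/-! ## Restriction to lines -/

section Generic

variable {d : ℕ}

lemma eventually_dot_ne_zero {Y : Finset (Fin d → ℝ)} {v : Fin d → ℝ} (h : ∀ y ∈ Y, y ⬝ᵥ v ≠ 0)
    (u : Fin d → ℝ) : ∀ᶠ s : ℝ in 𝓝 0, ∀ y ∈ Y, y ⬝ᵥ (v + s • u) ≠ 0 := by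
  rw [Filter.eventually_all_finset]
  intro y hy
  have hc : Tendsto (fun s : ℝ => y ⬝ᵥ v + s * (y ⬝ᵥ u)) (𝓝 0) (𝓝 (y ⬝ᵥ v + 0 * (y ⬝ᵥ u))) :=
    Continuous.tendsto (by fun_prop) _
  rw [zero_mul, add_zero] at hc
  filter_upwards [hc.eventually_ne (h y hy)] with s hs
  rwa [dotProduct_add, dotProduct_smul, smul_eq_mul]

/-- If `v` is orthogonal to the next vector `y`, a small move along `y` repairs this without
spoiling the finitely many open conditions already met. -/
lemma exists_dot_ne_zero (Y : Finset (Fin d → ℝ)) (h : ∀ y ∈ Y, y ≠ 0) :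
    ∃ v : Fin d → ℝ, ∀ y ∈ Y, y ⬝ᵥ v ≠ 0 := by
  classical
  induction Y using Finset.induction_on with
  | empty => exact ⟨0, by simp⟩
  | insert y Y hy ih =>
    obtain ⟨v, hv⟩ := ih fun z hz => h z (Finset.mem_insert_of_mem hz)
    by_cases h0 : y ⬝ᵥ v = 0
    · have h1 : ∀ᶠ s : ℝ in 𝓝[≠] 0, ∀ z ∈ Y, z ⬝ᵥ (v + s • y) ≠ 0 :=
        (eventually_dot_ne_zero hv y).filter_mono nhdsWithin_le_nhds
      obtain ⟨s, hs, hs0⟩ := (h1.and self_mem_nhdsWithin).exists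
      have hs0 : s ≠ 0 := hs0
      refine ⟨v + s • y, fun z hz => ?_⟩
      rcases Finset.mem_insert.1 hz with rfl | hz
      · rw [dotProduct_add, h0, zero_add, dotProduct_smul, smul_eq_mul]
        exact mul_ne_zero hs0 fun hh =>
          h z (Finset.mem_insert_self _ _) (dotProduct_self_eq_zero.1 hh)
      · exact hs z hz
    · refine ⟨v, fun z hz => ?_⟩
      rcases Finset.mem_insert.1 hz with rfl | hz
      · exact h0
      · exact hv z hz

/-- The direction `v` distinguishes the vectors `W i` up to sign. -/
structure Separates {ι : Type*} (W : ι → Fin d → ℝ) (v : Fin d → ℝ) : Prop where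
  eq_zero : ∀ i, W i ⬝ᵥ v = 0 → W i = 0
  eq_of_eq : ∀ i j, W i ⬝ᵥ v = W j ⬝ᵥ v → W i = W j
  eq_neg_of_eq : ∀ i j, W i ⬝ᵥ v = -(W j ⬝ᵥ v) → W i = -W j

open Classical in
/-- The nonzero vectors among `W i`, `W i - W j` and `W i + W j`. -/
noncomputable def separators {ι : Type*} [Fintype ι] (W : ι → Fin d → ℝ) : Finset (Fin d → ℝ) :=
  (Finset.univ.image W ∪ Finset.univ.image (fun q : ι × ι => W q.1 - W q.2) ∪
    Finset.univ.image (fun q : ι × ι => W q.1 + W q.2)).filter (· ≠ 0)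

lemma separates_of_separators {ι : Type*} [Fintype ι] {W : ι → Fin d → ℝ} {v : Fin d → ℝ}
    (h : ∀ y ∈ separators W, y ⬝ᵥ v ≠ 0) : Separates W v := by
  classical
  refine ⟨fun i hi => ?_, fun i j hij => ?_, fun i j hij => ?_⟩
  · by_contra h0
    exact h (W i) (by simp [separators, h0]) hi
  · by_contra h0
    refine h (W i - W j) ?_ (by rw [sub_dotProduct, hij, sub_self])
    simp only [separators, Finset.mem_filter, Finset.mem_union, Finset.mem_image, Finset.mem_univ,
      true_and]
    exact ⟨Or.inl (Or.inr ⟨(i, j), rfl⟩), sub_ne_zero.2 h0⟩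
  · by_contra h0
    refine h (W i + W j) ?_ (by rw [add_dotProduct, hij, neg_add_cancel])
    simp only [separators, Finset.mem_filter, Finset.mem_union, Finset.mem_image, Finset.mem_univ,
      true_and]
    exact ⟨Or.inr ⟨(i, j), rfl⟩, fun hh => h0 (eq_neg_of_add_eq_zero_left hh)⟩

lemma exists_separators {ι : Type*} [Fintype ι] (W : ι → Fin d → ℝ) :
    ∃ v : Fin d → ℝ, ∀ y ∈ separators W, y ⬝ᵥ v ≠ 0 :=
  exists_dot_ne_zero _ fun y hy => by
    classical
    exact (Finset.mem_filter.1 hy).2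

/-- Were all slices null, Fubini would make a translate of `A` null. No nonvanishing of `v` is
needed. -/
lemma exists_slice {A : Set (Input d)} (hA : MeasurableSet A) (h0 : volume A ≠ 0) (v : Input d) :
    ∃ x₀ : Input d, MeasurableSet {t : ℝ | x₀ + t • v ∈ A} ∧ volume {t : ℝ | x₀ + t • v ∈ A} ≠ 0 := by
  have hmeas : ∀ x₀ : Input d, MeasurableSet {t : ℝ | x₀ + t • v ∈ A} := fun x₀ =>
    (by fun_prop : Measurable fun t : ℝ => x₀ + t • v) hA
  by_contra! hcon
  have h1 : ∀ᵐ x : Input d, ∀ᵐ t : ℝ, ¬ (x + t • v ∈ A) := by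
    refine Eventually.of_forall fun x => ?_
    rw [ae_iff]
    simpa using hcon x (hmeas x)
  have hm : MeasurableSet {q : Input d × ℝ | q.1 + q.2 • v ∈ A} :=
    (by fun_prop : Measurable fun q : Input d × ℝ => q.1 + q.2 • v) hA
  rw [Measure.ae_ae_comm hm.compl] at h1
  obtain ⟨t, ht⟩ := h1.exists
  rw [ae_iff] at ht
  apply h0
  have : volume ((fun x : Input d => x + t • v) ⁻¹' A) = 0 := by
    simp only [not_not] at ht
    exact ht
  rwa [measure_preimage_add_right] at this

end Generic

/-! ### From lines back to networks on the input space -/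

section Networks

variable {k d : ℕ}

/-- The incoming weights of hidden node `i`. -/
def incoming (θ : Weights k d) (i : Fin k) : Fin d → ℝ := fun j => θ (.inr (i, some j))

lemma preactivation_eq (θ : Weights k d) (i : Fin k) (x : Input d) :
    preactivation θ i x = incoming θ i ⬝ᵥ x.ofLp + θ (.inr (i, none)) := rfl

lemma preactivation_line (θ : Weights k d) (i : Fin k) (x₀ : Input d) (v : Fin d → ℝ) (t : ℝ) :
    preactivation θ i (x₀ + t • WithLp.toLp 2 v) =
      (incoming θ i ⬝ᵥ v) * t + preactivation θ i x₀ := by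
  rw [preactivation_eq, preactivation_eq, WithLp.ofLp_add, WithLp.ofLp_smul, dotProduct_add,
    dotProduct_smul, smul_eq_mul]
  ring

lemma output_line (θ : Weights k d) (x₀ : Input d) (v : Fin d → ℝ) (t : ℝ) :
    output θ (x₀ + t • WithLp.toLp 2 v) = θ (.inl none) + ∑ i, θ (.inl (some i)) *
      Real.tanh ((incoming θ i ⬝ᵥ v) * t + preactivation θ i x₀) := by
  simp only [output, preactivation_line]
  ring

lemma IsIrreducible.incoming_ne {θ : Weights k d} (hθ : IsIrreducible θ) (i : Fin k) :
    incoming θ i ≠ 0 := by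
  obtain ⟨j, hj⟩ := hθ.incoming_ne_zero i
  exact fun h => hj (congrFun h j)

/-- Equal keys mean equal slopes and preactivations at `x₀`, up to a common sign. A separating `v`
lifts this to the incoming vectors; then the contribution of `x₀` cancels and the biases agree as
well, which irreducibility forbids. -/
lemma IsIrreducible.key_injective {θ : Weights k d} (hθ : IsIrreducible θ) {v : Fin d → ℝ}
    (hv : Separates (incoming θ) v) (x₀ : Input d) :
    Function.Injective fun i => (|incoming θ i ⬝ᵥ v|,
      preactivation θ i x₀ / (incoming θ i ⬝ᵥ v)) := by
  intro i i' h
  by_contra hne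
  have h1 := congrArg Prod.fst h
  have h2 := congrArg Prod.snd h
  simp only at h1 h2
  have hW : incoming θ i' ⬝ᵥ v ≠ 0 := fun hh => hθ.incoming_ne i' (hv.eq_zero _ hh)
  obtain ⟨s, hs1, hs2⟩ := exists_sign hW h1 h2
  rcases Int.units_eq_one_or s with rfl | rfl
  · simp only [Units.val_one, Int.cast_one, one_mul] at hs1 hs2
    have h3 := hv.eq_of_eq _ _ hs1
    obtain ⟨j, hj⟩ := hθ.ne_of_ne i i' hne
    apply hj
    cases j with
    | none =>
      rw [preactivation_eq, preactivation_eq, h3] at hs2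
      linarith
    | some j => exact congrFun h3 j
  · simp only [Units.val_neg, Units.val_one, Int.cast_neg, Int.cast_one, neg_mul, one_mul] at hs1 hs2
    have h3 := hv.eq_neg_of_eq _ _ hs1
    obtain ⟨j, hj⟩ := hθ.ne_neg_of_ne i i' hne
    apply hj
    cases j with
    | none =>
      rw [preactivation_eq, preactivation_eq, h3, neg_dotProduct] at hs2
      linarith
    | some j => exact congrFun h3 j

lemma exists_matching_line {N : Type*} (𝒰 : Ultrafilter N) (θs : N → Weights k d)
    {θ : Weights k d} (hθ : IsIrreducible θ) {A : Set (Input d)} (hA : MeasurableSet A)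
    (h0 : volume A ≠ 0) (h : ∀ x ∈ A, Tendsto (fun n => output (θs n) x) 𝒰 (𝓝 (output θ x)))
    {v : Fin d → ℝ} (hv : Separates (incoming θ) v) :
    ∃ (x₀ : Input d) (σ : Equiv.Perm (Fin k)) (s : Fin k → ℤˣ), ∀ i,
      Tendsto (fun n => θs n (.inl (some i))) 𝒰
        (𝓝 (((s i : ℤ) : ℝ) * θ (.inl (some (σ i))))) ∧
      Tendsto (fun n => incoming (θs n) i ⬝ᵥ v) 𝒰
        (𝓝 (((s i : ℤ) : ℝ) * (incoming θ (σ i) ⬝ᵥ v))) ∧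
      Tendsto (fun n => preactivation (θs n) i x₀) 𝒰
        (𝓝 (((s i : ℤ) : ℝ) * preactivation θ (σ i) x₀)) := by
  obtain ⟨x₀, hE, hE0⟩ := exists_slice hA h0 (WithLp.toLp 2 v)
  refine ⟨x₀, exists_matching 𝒰 (fun n => θs n (.inl none)) (fun n i => θs n (.inl (some i)))
    (fun n i => incoming (θs n) i ⬝ᵥ v) (fun n i => preactivation (θs n) i x₀) (θ (.inl none))
    (fun i => θ (.inl (some i))) (fun i => incoming θ i ⬝ᵥ v) (fun i => preactivation θ i x₀)
    hθ.outgoing_ne_zero (fun i hi => hθ.incoming_ne i (hv.eq_zero i hi)) (hθ.key_injective hv x₀)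
    hE hE0 fun t ht => ?_⟩
  have := h _ ht
  simpa only [output_line] using this

lemma tendsto_weights {N : Type*} {𝓕 : Filter N} {θs : N → Weights k d}
    (h : ∀ c, ∃ l, Tendsto (fun n => θs n c) 𝓕 (𝓝 l)) : ∃ θ, Tendsto θs 𝓕 (𝓝 θ) := by
  choose l hl using h
  refine ⟨WithLp.toLp 2 l, ?_⟩
  have := ((PiLp.continuous_toLp 2 (fun _ : OutIndex k ⊕ LdrIndex k d => ℝ)).tendsto l).comp
    (tendsto_pi_nhds.2 hl)
  exact this

lemma hasDerivAt_tanh (u : ℝ) : HasDerivAt Real.tanh (1 - Real.tanh u ^ 2) u := by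
  have h := (Real.hasDerivAt_sinh u).div (Real.hasDerivAt_cosh u) (Real.cosh_pos u).ne'
  have h1 : Real.tanh = Real.sinh / Real.cosh := funext Real.tanh_eq_sinh_div_cosh
  refine (h1 ▸ h).congr_deriv ?_
  have := (Real.cosh_pos u).ne'
  rw [Real.tanh_eq_sinh_div_cosh]
  field_simp

lemma continuous_tanh : Continuous Real.tanh :=
  continuous_iff_continuousAt.2 fun u => (hasDerivAt_tanh u).continuousAt

lemma continuous_output (x : Input d) : Continuous fun θ : Weights k d => output θ x := by
  have ht := continuous_tanh
  unfold output preactivation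
  fun_prop

/-- This replaces compactness of the weight space: convergence of outputs on a set of positive
measure prevents weights from escaping to infinity. -/
theorem exists_tendsto_of_output_tendsto {N : Type*} (𝒰 : Ultrafilter N) (θs : N → Weights k d)
    {θ : Weights k d} (hθ : IsIrreducible θ) {A : Set (Input d)} (hA : MeasurableSet A)
    (h0 : volume A ≠ 0) (h : ∀ x ∈ A, Tendsto (fun n => output (θs n) x) 𝒰 (𝓝 (output θ x))) :
    ∃ θ', Tendsto θs 𝒰 (𝓝 θ') := by
  obtain ⟨v, hv⟩ := exists_separators (incoming θ)
  obtain ⟨x₀, σ, s, hlim⟩ := exists_matching_line 𝒰 θs hθ hA h0 h (separates_of_separators hv)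
  have hW : ∀ i j, ∃ l, Tendsto (fun n => θs n (.inr (i, some j))) 𝒰 (𝓝 l) := by
    intro i j
    have h1 : ∀ᶠ r : ℝ in 𝓝[≠] 0, ∀ y ∈ separators (incoming θ),
        y ⬝ᵥ (v + r • Pi.single j (1 : ℝ)) ≠ 0 :=
      (eventually_dot_ne_zero hv _).filter_mono nhdsWithin_le_nhds
    obtain ⟨r, hr, hr0⟩ := (h1.and self_mem_nhdsWithin).exists
    have hr0 : r ≠ 0 := hr0
    -- The matching on the new line may differ from the first one. Only the existence of limits is
    -- used: the slopes along `v` and `v + r • e_j` both converge, hence so does their difference,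
    -- `r` times the weight from input `j`.
    obtain ⟨x₁, σ', s', hlim'⟩ :=
      exists_matching_line 𝒰 θs hθ hA h0 h (separates_of_separators hr)
    refine ⟨_, (((hlim' i).2.1.sub (hlim i).2.1).div_const r).congr fun n => ?_⟩
    rw [dotProduct_add, dotProduct_smul, dotProduct_single, add_sub_cancel_left, smul_eq_mul,
      mul_one, mul_div_cancel_left₀ _ hr0]
    rfl
  have hb : ∀ i, ∃ l, Tendsto (fun n => θs n (.inr (i, none))) 𝒰 (𝓝 l) := by
    intro i
    choose l hl using hW i
    refine ⟨_, ((hlim i).2.2.sub (tendsto_finsetSum Finset.univ fun j _ =>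
      (hl j).mul_const (x₀ j))).congr fun n => ?_⟩
    rw [preactivation]
    ring
  have ha : ∀ i, ∃ l, Tendsto (fun n => θs n (.inl (some i))) 𝒰 (𝓝 l) := fun i => ⟨_, (hlim i).1⟩
  obtain ⟨x, hx⟩ : A.Nonempty := by
    rw [Set.nonempty_iff_ne_empty]; rintro rfl; simp at h0
  have hα : ∃ l, Tendsto (fun n => θs n (.inl none)) 𝒰 (𝓝 l) := by
    choose la hla using ha
    choose lb hlb using hb
    choose lw hlw using hW
    have hu : ∀ i, Tendsto (fun n => preactivation (θs n) i x) 𝒰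
        (𝓝 (∑ j, lw i j * x j + lb i)) := fun i =>
      (tendsto_finsetSum Finset.univ fun j _ => (hlw i j).mul_const (x j)).add (hlb i)
    refine ⟨_, ((h x hx).sub (tendsto_finsetSum Finset.univ fun i _ =>
      (hla i).mul ((continuous_tanh.tendsto _).comp (hu i)))).congr fun n => ?_⟩
    rw [output]
    simp only [Function.comp]
    ring
  refine tendsto_weights fun c => ?_
  rcases c with (_ | i) | ⟨i, _ | j⟩
  · exact hα
  · exact ha i
  · exact hb i
  · exact hW i j

/-- The matching theorem for a constant sequence. The direction `v` separates the incoming vectors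
of both networks together, so equality of slopes up to sign becomes equality of vectors.
Irreducibility of `θ'` is a consequence. -/
theorem eq_relabel_of_output_eq {θ θ' : Weights k d} (hθ : IsIrreducible θ) {A : Set (Input d)}
    (hA : MeasurableSet A) (h0 : volume A ≠ 0) (h : ∀ x ∈ A, output θ' x = output θ x) :
    ∃ (σ : Equiv.Perm (Fin k)) (s : Fin k → ℤˣ), θ' = relabel σ s θ := by
  obtain ⟨v, hv⟩ := exists_separators (Sum.elim (incoming θ) (incoming θ'))
  have hsep := separates_of_separators hv
  have hsepθ : Separates (incoming θ) v := ⟨fun i => hsep.eq_zero (.inl i),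
    fun i j => hsep.eq_of_eq (.inl i) (.inl j), fun i j => hsep.eq_neg_of_eq (.inl i) (.inl j)⟩
  obtain ⟨x₀, σ, s, hlim⟩ := exists_matching_line (pure () : Ultrafilter Unit) (fun _ => θ') hθ hA h0
    (fun x hx => by rw [h x hx]; exact tendsto_const_nhds) hsepθ
  refine ⟨σ, s, ?_⟩
  have ha : ∀ i, θ' (.inl (some i)) = ((s i : ℤ) : ℝ) * θ (.inl (some (σ i))) := fun i =>
    tendsto_nhds_unique tendsto_const_nhds (hlim i).1
  have hw : ∀ i, incoming θ' i = ((s i : ℤ) : ℝ) • incoming θ (σ i) := by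
    intro i
    have h1 := tendsto_nhds_unique tendsto_const_nhds (hlim i).2.1
    rcases Int.units_eq_one_or (s i) with hs | hs
    · simp only [hs, Units.val_one, Int.cast_one, one_mul, one_smul] at h1 ⊢
      exact hsep.eq_of_eq (.inr i) (.inl (σ i)) h1
    · simp only [hs, Units.val_neg, Units.val_one, Int.cast_neg, Int.cast_one, neg_mul, one_mul,
        neg_smul, one_smul] at h1 ⊢
      exact hsep.eq_neg_of_eq (.inr i) (.inl (σ i)) h1
  have hb : ∀ i, θ' (.inr (i, none)) = ((s i : ℤ) : ℝ) * θ (.inr (σ i, none)) := by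
    intro i
    have h1 := tendsto_nhds_unique tendsto_const_nhds (hlim i).2.2
    rw [preactivation_eq, preactivation_eq, hw, smul_dotProduct, smul_eq_mul] at h1
    linarith
  have hldr : ∀ c, θ' (.inr c) = relabel σ s θ (.inr c) := by
    rintro ⟨i, _ | j⟩
    · exact hb i
    · exact congrFun (hw i) j
  obtain ⟨x, hx⟩ : A.Nonempty := by
    rw [Set.nonempty_iff_ne_empty]; rintro rfl; simp at h0
  have hα : θ' (.inl none) = relabel σ s θ (.inl none) := by
    have h1 := h x hx
    rw [← output_relabel σ s θ, output, output] at h1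
    have h2 : ∑ i, θ' (.inl (some i)) * Real.tanh (preactivation θ' i x) =
        ∑ i, relabel σ s θ (.inl (some i)) * Real.tanh (preactivation (relabel σ s θ) i x) := by
      refine Finset.sum_congr rfl fun i _ => ?_
      rw [ha i]
      simp only [preactivation, hldr]
      rfl
    linarith
  ext c
  rcases c with (_ | i) | c
  · exact hα
  · exact ha i
  · exact hldr c

/-- The derivative of the network function in the weights, in direction `h`. -/
noncomputable def outputDeriv (θ h : Weights k d) (x : Input d) : ℝ :=
  h (.inl none) + ∑ i, (h (.inl (some i)) * Real.tanh (preactivation θ i x) +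
    θ (.inl (some i)) * preactivation h i x * (1 - Real.tanh (preactivation θ i x) ^ 2))

/-- On a separating line `tanh_independent` applies, and nonzero outgoing weights of `θ` can be
divided out. Perturbing the line in each coordinate direction then kills every incoming weight of
`h`. -/
theorem eq_zero_of_outputDeriv_eq_zero {θ h : Weights k d} (hθ : IsIrreducible θ)
    {A : Set (Input d)} (hA : MeasurableSet A) (h0 : volume A ≠ 0)
    (hz : ∀ x ∈ A, outputDeriv θ h x = 0) : h = 0 := by
  have key : ∀ v, Separates (incoming θ) v → ∃ x₀ : Input d, ∀ i, h (.inl (some i)) = 0 ∧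
      incoming h i ⬝ᵥ v = 0 ∧ preactivation h i x₀ = 0 := by
    intro v hv
    obtain ⟨x₀, hE, hE0⟩ := exists_slice hA h0 (WithLp.toLp 2 v)
    refine ⟨x₀, fun i => ?_⟩
    obtain ⟨h1, h2, h3⟩ := tanh_independent (h (.inl none)) (fun i => h (.inl (some i)))
      (fun i => θ (.inl (some i)) * (incoming h i ⬝ᵥ v))
      (fun i => θ (.inl (some i)) * preactivation h i x₀)
      (fun i => incoming θ i ⬝ᵥ v) (fun i => preactivation θ i x₀)
      (fun i hi => hθ.incoming_ne i (hv.eq_zero i hi)) (hθ.key_injective hv x₀) hE0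
      (fun t ht => by
        have := hz _ ht
        rw [outputDeriv] at this
        simp only [preactivation_line] at this
        rw [← this]
        congr 1
        refine Finset.sum_congr rfl fun i _ => ?_
        ring) i
    exact ⟨h1, (mul_eq_zero.1 h2).resolve_left (hθ.outgoing_ne_zero i),
      (mul_eq_zero.1 h3).resolve_left (hθ.outgoing_ne_zero i)⟩
  obtain ⟨v, hv⟩ := exists_separators (incoming θ)
  obtain ⟨x₀, hx₀⟩ := key v (separates_of_separators hv)
  have hW : ∀ i j, h (.inr (i, some j)) = 0 := by
    intro i j
    have h1 : ∀ᶠ r : ℝ in 𝓝[≠] 0, ∀ y ∈ separators (incoming θ),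
        y ⬝ᵥ (v + r • Pi.single j (1 : ℝ)) ≠ 0 :=
      (eventually_dot_ne_zero hv _).filter_mono nhdsWithin_le_nhds
    obtain ⟨r, hr, hr0⟩ := (h1.and self_mem_nhdsWithin).exists
    have hr0 : r ≠ 0 := hr0
    obtain ⟨x₁, hx₁⟩ := key _ (separates_of_separators hr)
    have h2 := (hx₁ i).2.1
    rw [dotProduct_add, (hx₀ i).2.1, dotProduct_smul, dotProduct_single, zero_add, smul_eq_mul,
      mul_one] at h2
    exact (mul_eq_zero.1 h2).resolve_left hr0
  have hb : ∀ i, h (.inr (i, none)) = 0 := by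
    intro i
    have h1 := (hx₀ i).2.2
    rw [preactivation] at h1
    simpa [hW] using h1
  have ha : ∀ i, h (.inl (some i)) = 0 := fun i => (hx₀ i).1
  obtain ⟨x, hx⟩ : A.Nonempty := by
    rw [Set.nonempty_iff_ne_empty]; rintro rfl; simp at h0
  have hα : h (.inl none) = 0 := by
    have h1 := hz x hx
    simpa [outputDeriv, preactivation, ha, hb, hW] using h1
  ext c
  rcases c with (_ | i) | ⟨i, _ | j⟩
  · exact hα
  · exact ha i
  · exact hb i
  · exact hW i j

end Networks

end LDR

namespace LDR

variable {k d : ℕ}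

/-! ## The weight metric on the factor space -/

lemma norm_relabel_sub (σ : Equiv.Perm (Fin k)) (s : Fin k → ℤˣ) (θ θ' : Weights k d) :
    ‖relabel σ s θ - relabel σ s θ'‖ = ‖θ - θ'‖ := by
  have hs : ∀ (u : ℤˣ) (x y : ℝ), (((u : ℤ) : ℝ) * x - ((u : ℤ) : ℝ) * y) ^ 2 = (x - y) ^ 2 := by
    intro u x y
    rw [← mul_sub, mul_pow, pow_two ((u : ℤ) : ℝ), sign_mul_self, one_mul]
  rw [EuclideanSpace.norm_eq, EuclideanSpace.norm_eq]
  congr 1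
  simp only [Fintype.sum_sum_type, Fintype.sum_option, Fintype.sum_prod_type, PiLp.sub_apply,
    Real.norm_eq_abs, sq_abs, relabel, hs]
  rw [Equiv.sum_comp σ fun i => (θ (.inl (some i)) - θ' (.inl (some i))) ^ 2,
    Equiv.sum_comp σ fun i => (θ (.inr (i, none)) - θ' (.inr (i, none))) ^ 2 +
      ∑ j, (θ (.inr (i, some j)) - θ' (.inr (i, some j))) ^ 2]

lemma IsIrreducible.relabel {θ : Weights k d} (hθ : IsIrreducible θ) (σ : Equiv.Perm (Fin k))
    (s : Fin k → ℤˣ) : IsIrreducible (relabel σ s θ) := by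
  have hne : ∀ u : ℤˣ, ((u : ℤ) : ℝ) ≠ 0 := fun u h => by
    have := sign_mul_self u
    rw [h] at this
    norm_num at this
  refine ⟨fun i => mul_ne_zero (hne _) (hθ.outgoing_ne_zero _), fun i => ?_, fun i i' h => ?_,
    fun i i' h => ?_⟩
  · obtain ⟨j, hj⟩ := hθ.incoming_ne_zero (σ i)
    exact ⟨j, mul_ne_zero (hne _) hj⟩
  all_goals
    obtain ⟨j, hj⟩ := hθ.ne_of_ne (σ i) (σ i') (σ.injective.ne h)
    obtain ⟨j', hj'⟩ := hθ.ne_neg_of_ne (σ i) (σ i') (σ.injective.ne h)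
    simp only [LDR.relabel]
    rcases Int.units_eq_one_or (s i) with h1 | h1 <;> rcases Int.units_eq_one_or (s i') with h2 | h2
  · exact ⟨j, by simpa [h1, h2] using hj⟩
  · exact ⟨j', by simpa [h1, h2] using hj'⟩
  · exact ⟨j', by simpa [h1, h2, neg_eq_iff_eq_neg] using hj'⟩
  · exact ⟨j, by simpa [h1, h2] using hj⟩
  · exact ⟨j', by simpa [h1, h2] using hj'⟩
  · exact ⟨j, by simpa [h1, h2] using hj⟩
  · exact ⟨j, by simpa [h1, h2] using hj⟩
  · exact ⟨j', by simpa [h1, h2, neg_eq_iff_eq_neg] using hj'⟩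

variable {p : Input d → ℝ}

/-- Relabelling of the hidden nodes of a network in the model. -/
def Network.relabel (θ : Network p k) (σ : Equiv.Perm (Fin k)) (s : Fin k → ℤˣ) : Network p k :=
  ⟨LDR.relabel σ s θ.1, θ.2.1.relabel σ s, by rw [IsAdmissible, output_relabel]; exact θ.2.2⟩

lemma toFactor_relabel (θ : Network p k) (σ : Equiv.Perm (Fin k)) (s : Fin k → ℤˣ) :
    toFactor (θ.relabel σ s) = toFactor θ :=
  (Quotient.sound (s := networkSetoid p k) ⟨σ, s, rfl⟩).symm

lemma exists_relabel_of_toFactor_eq {θ θ' : Network p k} (h : toFactor θ = toFactor θ') :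
    ∃ σ s, θ' = θ.relabel σ s := by
  obtain ⟨σ, s, h⟩ := Quotient.exact (s := networkSetoid p k) h
  exact ⟨σ, s, Subtype.ext h⟩

lemma exists_toFactor (q : FactorSpace p k) : ∃ θ : Network p k, toFactor θ = q :=
  Quotient.exists_rep (s := networkSetoid p k) q

lemma weightDist_nonneg (q q' : FactorSpace p k) : 0 ≤ weightDist q q' := by
  refine Real.sInf_nonneg ?_
  rintro _ ⟨θ, θ', -, -, rfl⟩
  exact norm_nonneg _

lemma weightDist_le (θ θ' : Network p k) :
    weightDist (toFactor θ) (toFactor θ') ≤ ‖θ.1 - θ'.1‖ := by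
  refine csInf_le ⟨0, ?_⟩ ⟨θ, θ', rfl, rfl, rfl⟩
  rintro _ ⟨θ, θ', -, -, rfl⟩
  exact norm_nonneg _

/-- A relabelling that carries the first representative to `θ` can be applied to both without
changing their distance, and then only finitely many second representatives remain. -/
lemma exists_weightDist_eq (θ : Network p k) (q' : FactorSpace p k) :
    ∃ θ' : Network p k, toFactor θ' = q' ∧ weightDist (toFactor θ) q' = ‖θ.1 - θ'.1‖ := by
  obtain ⟨θ', rfl⟩ := exists_toFactor q'
  obtain ⟨g, hg⟩ := Finite.exists_min fun g : Equiv.Perm (Fin k) × (Fin k → ℤˣ) =>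
    ‖θ.1 - (θ'.relabel g.1 g.2).1‖
  refine ⟨θ'.relabel g.1 g.2, toFactor_relabel _ _ _, le_antisymm ?_ ?_⟩
  · rw [← toFactor_relabel θ' g.1 g.2]
    exact weightDist_le _ _
  · refine le_csInf ⟨_, θ, θ', rfl, rfl, rfl⟩ ?_
    rintro _ ⟨θ₁, θ₁', h1, h2, rfl⟩
    obtain ⟨σ, s, rfl⟩ := exists_relabel_of_toFactor_eq h1
    obtain ⟨σ', s', h3⟩ := exists_relabel_of_toFactor_eq
      (h2.symm.trans (toFactor_relabel θ₁' σ s).symm)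
    rw [← norm_relabel_sub σ s θ₁.1 θ₁'.1]
    have := hg (σ', s')
    rw [← h3] at this
    exact this

lemma isMetric_weightDist : IsMetric (weightDist (k := k) (p := p)) where
  nonneg := weightDist_nonneg
  eq_zero_iff q q' := by
    constructor
    · intro h
      obtain ⟨θ, rfl⟩ := exists_toFactor q
      obtain ⟨θ', rfl, h'⟩ := exists_weightDist_eq θ q'
      rw [h, eq_comm, norm_eq_zero, sub_eq_zero] at h'
      exact congrArg toFactor (Subtype.ext h')
    · rintro rfl
      obtain ⟨θ, rfl⟩ := exists_toFactor q
      refine le_antisymm ((weightDist_le θ θ).trans_eq (by simp)) (weightDist_nonneg _ _)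
  symm q q' := by
    unfold weightDist
    congr 1
    ext r
    constructor
    all_goals
      rintro ⟨θ, θ', h1, h2, rfl⟩
      exact ⟨θ', θ, h2, h1, norm_sub_rev _ _⟩
  triangle q q' q'' := by
    obtain ⟨θ, rfl⟩ := exists_toFactor q
    obtain ⟨θ', rfl, h'⟩ := exists_weightDist_eq θ q'
    obtain ⟨θ'', rfl, h''⟩ := exists_weightDist_eq θ' q''
    rw [h', h'']
    refine (weightDist_le θ θ'').trans ?_
    calc ‖θ.1 - θ''.1‖ = ‖(θ.1 - θ'.1) + (θ'.1 - θ''.1)‖ := by congr 1; abel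
      _ ≤ _ := norm_add_le _ _

/-! ## Estimates for the network function -/

lemma abs_tanh_sub_le (u v : ℝ) : |Real.tanh u - Real.tanh v| ≤ |u - v| := by
  have := Convex.norm_image_sub_le_of_norm_hasDerivWithin_le (f := Real.tanh) (C := 1)
    (s := Set.univ) (fun x _ => (hasDerivAt_tanh x).hasDerivWithinAt) (fun x _ => by
      have := Real.tanh_sq_lt_one x
      rw [Real.norm_eq_abs, abs_le]
      constructor <;> nlinarith [sq_nonneg (Real.tanh x)]) convex_univ (Set.mem_univ v)
    (Set.mem_univ u)
  simpa using this

lemma abs_preactivation_sub_le (θ θ' : Weights k d) (i : Fin k) (x : Input d) :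
    |preactivation θ i x - preactivation θ' i x| ≤ ((d + 1) * (1 + ‖x‖)) * ‖θ - θ'‖ := by
  have hc : ∀ c, |θ c - θ' c| ≤ ‖θ - θ'‖ := fun c => PiLp.norm_apply_le (θ - θ') c
  have hx : ∀ j, |x j| ≤ ‖x‖ := fun j => PiLp.norm_apply_le x j
  have h1 : preactivation θ i x - preactivation θ' i x =
      ∑ j, (θ (.inr (i, some j)) - θ' (.inr (i, some j))) * x j +
        (θ (.inr (i, none)) - θ' (.inr (i, none))) := by
    simp only [preactivation, sub_mul, Finset.sum_sub_distrib]
    ring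
  rw [h1]
  calc _ ≤ ∑ j : Fin d, ‖θ - θ'‖ * ‖x‖ + ‖θ - θ'‖ := by
        refine (abs_add_le _ _).trans (add_le_add ((Finset.abs_sum_le_sum_abs _ _).trans
          (Finset.sum_le_sum fun j _ => ?_)) (hc _))
        rw [abs_mul]
        exact mul_le_mul (hc _) (hx j) (abs_nonneg _) (norm_nonneg _)
    _ ≤ _ := by
        rw [Finset.sum_const, Finset.card_univ, Fintype.card_fin, nsmul_eq_mul]
        have : 0 ≤ ‖θ - θ'‖ := norm_nonneg _
        have : 0 ≤ ‖x‖ := norm_nonneg _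
        have : (0 : ℝ) ≤ d := Nat.cast_nonneg d
        have : 0 ≤ ‖θ - θ'‖ * ‖x‖ := by positivity
        have : 0 ≤ ‖θ - θ'‖ * d := by positivity
        linarith

/-- The product rule is arranged so that `θ'` occurs only inside the bounded function `tanh`; the
Lipschitz constant thus depends on `θ` alone and the estimate is global in `θ'`. -/
lemma abs_output_sub_le (θ θ' : Weights k d) (x : Input d) :
    |output θ x - output θ' x| ≤
      (1 + k + (∑ i, |θ (.inl (some i))|) * (d + 1)) * (1 + ‖x‖) * ‖θ - θ'‖ := by
  have hc : ∀ c, |θ c - θ' c| ≤ ‖θ - θ'‖ := fun c => PiLp.norm_apply_le (θ - θ') c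
  have h1 : output θ x - output θ' x =
      ∑ i, ((θ (.inl (some i)) - θ' (.inl (some i))) * Real.tanh (preactivation θ' i x) +
        θ (.inl (some i)) * (Real.tanh (preactivation θ i x) - Real.tanh (preactivation θ' i x))) +
        (θ (.inl none) - θ' (.inl none)) := by
    have : ∀ i, (θ (.inl (some i)) - θ' (.inl (some i))) * Real.tanh (preactivation θ' i x) +
        θ (.inl (some i)) * (Real.tanh (preactivation θ i x) - Real.tanh (preactivation θ' i x)) =
        θ (.inl (some i)) * Real.tanh (preactivation θ i x) -
          θ' (.inl (some i)) * Real.tanh (preactivation θ' i x) := fun i => by ring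
    simp only [this, Finset.sum_sub_distrib, output]
    ring
  rw [h1]
  calc _ ≤ ∑ i, (‖θ - θ'‖ + |θ (.inl (some i))| * (((d + 1) * (1 + ‖x‖)) * ‖θ - θ'‖)) +
        ‖θ - θ'‖ := by
        refine (abs_add_le _ _).trans (add_le_add ((Finset.abs_sum_le_sum_abs _ _).trans
          (Finset.sum_le_sum fun i _ => (abs_add_le _ _).trans (add_le_add ?_ ?_))) (hc _))
        · rw [abs_mul]
          calc _ ≤ ‖θ - θ'‖ * 1 := mul_le_mul (hc _) (Real.abs_tanh_lt_one _).le (abs_nonneg _)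
                (norm_nonneg _)
            _ = _ := mul_one _
        · rw [abs_mul]
          exact mul_le_mul_of_nonneg_left ((abs_tanh_sub_le _ _).trans
            (abs_preactivation_sub_le θ θ' i x)) (abs_nonneg _)
    _ ≤ _ := by
        rw [Finset.sum_add_distrib, ← Finset.sum_mul, Finset.sum_const, Finset.card_univ,
          Fintype.card_fin, nsmul_eq_mul]
        have : 0 ≤ ‖θ - θ'‖ * ‖x‖ := by positivity
        have : 0 ≤ k * (‖θ - θ'‖ * ‖x‖) := by positivity
        linarith

lemma measurable_output (θ : Weights k d) : Measurable (output θ) := by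
  have := continuous_tanh.measurable
  unfold output preactivation
  fun_prop

lemma exists_hasFDerivAt_output (θ : Weights k d) (x : Input d) :
    ∃ L : Weights k d →L[ℝ] ℝ, HasFDerivAt (fun θ => output θ x) L θ ∧
      ∀ h, L h = outputDeriv θ h x := by
  set pr : OutIndex k ⊕ LdrIndex k d → Weights k d →L[ℝ] ℝ := fun c => EuclideanSpace.proj c with hpr
  set P : Fin k → Weights k d →L[ℝ] ℝ := fun i =>
    ∑ j, x j • pr (.inr (i, some j)) + pr (.inr (i, none)) with hP
  have hPa : ∀ i h, P i h = preactivation h i x := by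
    intro i h
    simp [hP, hpr, preactivation, mul_comm]
  have hpre : ∀ i, HasFDerivAt (fun θ : Weights k d => preactivation θ i x) (P i) θ := by
    intro i
    rw [show (fun θ : Weights k d => preactivation θ i x) = P i from (funext (hPa i)).symm]
    exact (P i).hasFDerivAt
  have hsum : HasFDerivAt (fun θ => output θ x) (∑ i, (θ (.inl (some i)) •
      ((1 - Real.tanh (preactivation θ i x) ^ 2) • P i) +
        Real.tanh (preactivation θ i x) • pr (.inl (some i))) + pr (.inl none)) θ := by
    refine HasFDerivAt.add (HasFDerivAt.fun_sum fun i _ => ?_) (pr (.inl none)).hasFDerivAt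
    exact (pr (.inl (some i))).hasFDerivAt.mul ((hasDerivAt_tanh _).comp_hasFDerivAt θ (hpre i))
  refine ⟨_, hsum, fun h => ?_⟩
  simp only [_root_.add_apply, _root_.sum_apply,
    _root_.smul_apply, hPa, smul_eq_mul, outputDeriv]
  have e : ∀ c, pr c h = h c := fun c => rfl
  simp only [e]
  rw [add_comm]
  congr 1
  exact Finset.sum_congr rfl fun i _ => by ring

end LDR

namespace LDR

variable {k d : ℕ} {p : Input d → ℝ}

/-! ## The Hellinger metric -/

lemma IsInputDensity.integrable (hp : IsInputDensity p) : Integrable p := by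
  by_contra h
  have := hp.integral_eq_one
  rw [integral_undef h] at this
  exact zero_ne_one this

/-- Since `p` has integral one, `0 < p x` on a set of positive measure, and a measurable null set
can be removed from it. The analytic arguments need the property at every point of the set. -/
lemma IsInputDensity.exists_set (hp : IsInputDensity p) {P : Input d → Prop}
    (h : ∀ᵐ x, 0 < p x → P x) :
    ∃ A : Set (Input d), MeasurableSet A ∧ volume A ≠ 0 ∧ ∀ x ∈ A, 0 < p x ∧ P x := by
  have hpos : MeasurableSet {x | 0 < p x} := measurableSet_lt measurable_const hp.measurable
  rw [ae_iff] at h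
  set T := toMeasurable volume {x | ¬ (0 < p x → P x)} with hT
  have hT0 : volume T = 0 := by rw [hT, measure_toMeasurable, h]
  refine ⟨{x | 0 < p x} \ T, hpos.diff (measurableSet_toMeasurable _ _), ?_, fun x hx => ⟨hx.1, ?_⟩⟩
  · rw [measure_sdiff_null hT0]
    intro h0
    have h1 : ∀ᵐ x, p x = 0 := by
      have : ∀ᵐ x : Input d, ¬ 0 < p x := by rw [ae_iff]; simpa using h0
      filter_upwards [this] with x hx
      exact le_antisymm (not_lt.1 hx) (hp.nonneg x)
    have h2 := hp.integral_eq_one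
    rw [integral_congr_ae h1, integral_zero] at h2
    exact zero_ne_one h2
  · by_contra hcon
    exact hx.2 (subset_toMeasurable _ _ fun himp => hcon (himp hx.1))

lemma Network.ae_pos (θ : Network p k) :
    ∀ᵐ x : Input d, 0 < p x → 0 < output θ.1 x ∧ output θ.1 x < 1 := by
  obtain ⟨δ, hδ, h⟩ := θ.2.2
  filter_upwards [h] with x hx hpx
  have := hx hpx
  constructor <;> linarith

lemma Network.ae_density (hp : IsInputDensity p) (θ : Network p k) :
    ∀ᵐ x : Input d, ∀ y, 0 ≤ density p θ.1 (x, y) ∧ density p θ.1 (x, y) ≤ p x := by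
  filter_upwards [θ.ae_pos] with x hx y
  rcases (hp.nonneg x).eq_or_lt with h0 | h0
  · cases y <;> simp [density, ← h0]
  · obtain ⟨h1, h2⟩ := hx h0
    cases y
    · simp only [density, Bool.false_eq_true, if_false]
      constructor <;> nlinarith
    · simp only [density, if_true]
      constructor <;> nlinarith

lemma Network.ae_density_prod (hp : IsInputDensity p) (θ : Network p k) :
    ∀ᵐ z ∂(baseMeasure d), 0 ≤ density p θ.1 z ∧ density p θ.1 z ≤ p z.1 := by
  have := Measure.quasiMeasurePreserving_fst (μ := (volume : Measure (Input d)))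
    (ν := (Measure.count : Measure Bool)) |>.ae (θ.ae_density hp)
  filter_upwards [this] with z hz using hz z.2

lemma measurable_density (hp : IsInputDensity p) (θ : Weights k d) : Measurable (density p θ) := by
  have h1 := hp.measurable
  have h2 := measurable_output θ
  unfold density
  refine Measurable.ite (measurable_snd (MeasurableSet.of_discrete (s := {b : Bool | b = true}))) ?_ ?_
  all_goals fun_prop

lemma Network.memLp_sqrt (hp : IsInputDensity p) (θ : Network p k) :
    MemLp (fun z => √(density p θ.1 z)) 2 (baseMeasure d) := by
  have hm : AEStronglyMeasurable (fun z => √(density p θ.1 z)) (baseMeasure d) :=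
    (measurable_density hp θ.1).sqrt.aestronglyMeasurable
  rw [memLp_two_iff_integrable_sq hm]
  have hint : Integrable (fun z : Input d × Bool => p z.1) (baseMeasure d) :=
    hp.integrable.comp_fst _
  refine hint.mono' (hm.pow 2) ?_
  filter_upwards [θ.ae_density_prod hp] with z hz
  rw [Real.sq_sqrt hz.1, Real.norm_eq_abs, abs_of_nonneg hz.1]
  exact hz.2

lemma hellingerSq_toFactor (θ θ' : Network p k) : hellingerSq (toFactor θ) (toFactor θ') =
    ∫ z, (√(density p θ.1 z) - √(density p θ'.1 z)) ^ 2 ∂(baseMeasure d) := rfl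

lemma hellingerDist_eq_eLpNorm (hp : IsInputDensity p) (θ θ' : Network p k) :
    hellingerDist (toFactor θ) (toFactor θ') =
      (eLpNorm ((fun z => √(density p θ.1 z)) - fun z => √(density p θ'.1 z)) 2
        (baseMeasure d)).toReal := by
  rw [((θ.memLp_sqrt hp).sub (θ'.memLp_sqrt hp)).eLpNorm_eq_integral_rpow_norm two_ne_zero
    ENNReal.ofNat_ne_top, ENNReal.toReal_ofReal (by positivity), hellingerDist,
    hellingerSq_toFactor, Real.sqrt_eq_rpow]
  simp

lemma hellingerSq_nonneg (q q' : FactorSpace p k) : 0 ≤ hellingerSq q q' :=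
  integral_nonneg fun _ => sq_nonneg _

lemma hellingerDist_sq (q q' : FactorSpace p k) : hellingerDist q q' ^ 2 = hellingerSq q q' :=
  Real.sq_sqrt (hellingerSq_nonneg q q')

lemma Network.integrable_sq (hp : IsInputDensity p) (θ θ' : Network p k) :
    Integrable (fun z => (√(density p θ.1 z) - √(density p θ'.1 z)) ^ 2) (baseMeasure d) :=
  ((θ.memLp_sqrt hp).sub (θ'.memLp_sqrt hp)).integrable_sq

lemma eq_of_ae_output_eq (hp : IsInputDensity p) {θ θ' : Network p k}
    (h : ∀ᵐ x : Input d, 0 < p x → output θ'.1 x = output θ.1 x) : toFactor θ = toFactor θ' := by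
  obtain ⟨A, hA, h0, hAP⟩ := hp.exists_set h
  obtain ⟨σ, s, hs⟩ := eq_relabel_of_output_eq θ.2.1 hA h0 fun x hx => (hAP x hx).2
  exact Quotient.sound (s := networkSetoid p k) ⟨σ, s, hs⟩

/-- The triangle inequality is Minkowski's for square roots of densities. Separation is
identifiability, read off from the label `true`. -/
lemma isMetric_hellingerDist (hp : IsInputDensity p) :
    IsMetric (hellingerDist (k := k) (p := p)) where
  nonneg q q' := Real.sqrt_nonneg _
  eq_zero_iff q q' := by
    obtain ⟨θ, rfl⟩ := exists_toFactor q
    obtain ⟨θ', rfl⟩ := exists_toFactor q'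
    constructor
    · intro h
      have h1 : hellingerSq (toFactor θ) (toFactor θ') = 0 := by
        rw [← hellingerDist_sq, h]; norm_num
      rw [hellingerSq_toFactor, integral_eq_zero_iff_of_nonneg (fun z => sq_nonneg _)
        (θ.integrable_sq hp θ')] at h1
      have h2 := Measure.ae_ae_of_ae_prod h1
      apply eq_of_ae_output_eq hp
      filter_upwards [h2, θ.ae_density hp, θ'.ae_density hp] with x hx hd hd' hpx
      have h3 := Measure.ae_count_iff.1 hx true
      simp only [Pi.zero_apply, ne_eq, OfNat.ofNat_ne_zero, not_false_eq_true, pow_eq_zero_iff,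
        sub_eq_zero] at h3
      rw [Real.sqrt_inj (hd true).1 (hd' true).1] at h3
      simp only [density, if_true] at h3
      exact (mul_left_cancel₀ hpx.ne' h3).symm
    · intro h
      rw [← h, hellingerDist, hellingerSq]
      simp
  symm q q' := by
    unfold hellingerDist hellingerSq
    congr 2
    funext z
    ring
  triangle q q' q'' := by
    obtain ⟨θ, rfl⟩ := exists_toFactor q
    obtain ⟨θ', rfl⟩ := exists_toFactor q'
    obtain ⟨θ'', rfl⟩ := exists_toFactor q''
    simp only [hellingerDist_eq_eLpNorm hp]
    have h1 := (θ.memLp_sqrt hp).sub (θ'.memLp_sqrt hp)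
    have h2 := (θ'.memLp_sqrt hp).sub (θ''.memLp_sqrt hp)
    rw [← ENNReal.toReal_add h1.2.ne h2.2.ne]
    refine ENNReal.toReal_mono (ENNReal.add_ne_top.2 ⟨h1.2.ne, h2.2.ne⟩) ?_
    rw [← sub_add_sub_cancel _ (fun z => √(density p θ'.1 z))]
    exact eLpNorm_add_le h1.1 h2.1 (by norm_num)

/-! ## Comparison of the two metrics -/

lemma hellingerSq_eq_integral (hp : IsInputDensity p) (θ θ' : Network p k) :
    Integrable (fun x => (√(p x * output θ.1 x) - √(p x * output θ'.1 x)) ^ 2 +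
      (√(p x * (1 - output θ.1 x)) - √(p x * (1 - output θ'.1 x))) ^ 2) ∧
    hellingerSq (toFactor θ) (toFactor θ') =
      ∫ x, ((√(p x * output θ.1 x) - √(p x * output θ'.1 x)) ^ 2 +
        (√(p x * (1 - output θ.1 x)) - √(p x * (1 - output θ'.1 x))) ^ 2) := by
  have hint := θ.integrable_sq hp θ'
  have h1 := hint.integral_prod_left
  have h2 := integral_prod _ hint
  simp only [integral_count, Fintype.sum_bool, density, if_true, Bool.false_eq_true, if_false]
    at h1 h2
  exact ⟨h1, h2⟩

lemma sq_sqrt_sub_sqrt_le {a b : ℝ} (ha : 0 < a) (hb : 0 ≤ b) :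
    (√a - √b) ^ 2 ≤ (a - b) ^ 2 / a := by
  rw [le_div_iff₀ ha]
  have h1 : a - b = (√a - √b) * (√a + √b) := by
    have := Real.mul_self_sqrt ha.le
    have := Real.mul_self_sqrt hb
    linarith
  rw [h1, mul_pow]
  have h2 : a ≤ (√a + √b) ^ 2 := by
    nlinarith [Real.mul_self_sqrt ha.le, Real.sqrt_nonneg a, Real.sqrt_nonneg b,
      mul_nonneg (Real.sqrt_nonneg a) (Real.sqrt_nonneg b), sq_nonneg (√b)]
  gcongr

lemma mul_sq_sub_le {r a b : ℝ} (hr : 0 ≤ r) (ha : 0 ≤ a) (ha1 : a ≤ 1) (hb : 0 ≤ b)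
    (hb1 : b ≤ 1) : r * (a - b) ^ 2 ≤ 4 * (√(r * a) - √(r * b)) ^ 2 := by
  rw [Real.sqrt_mul hr, Real.sqrt_mul hr, ← mul_sub, mul_pow, Real.sq_sqrt hr]
  have h1 : a - b = (√a - √b) * (√a + √b) := by
    have := Real.mul_self_sqrt ha
    have := Real.mul_self_sqrt hb
    linarith
  have h2 : √a ≤ 1 := Real.sqrt_le_one.2 ha1
  have h3 : √b ≤ 1 := Real.sqrt_le_one.2 hb1
  have h4 : (√a + √b) ^ 2 ≤ 4 := by
    nlinarith [Real.sqrt_nonneg a, Real.sqrt_nonneg b]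
  rw [h1, mul_pow]
  calc r * ((√a - √b) ^ 2 * (√a + √b) ^ 2) ≤ r * ((√a - √b) ^ 2 * 4) := by gcongr
    _ = _ := by ring

lemma exists_hellingerSq_le (hp : IsInputDensity p) (θ : Network p k) :
    ∃ M > 0, ∀ θ' : Network p k,
      hellingerSq (toFactor θ) (toFactor θ') ≤ M * ‖θ.1 - θ'.1‖ ^ 2 := by
  obtain ⟨δ, hδ, hadm⟩ := θ.2.2
  set C : ℝ := 1 + k + (∑ i, |θ.1 (.inl (some i))|) * (d + 1) with hC
  have hC0 : 0 ≤ C := by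
    have : 0 ≤ ∑ i, |θ.1 (.inl (some i))| := Finset.sum_nonneg fun _ _ => abs_nonneg _
    positivity
  have hmom : Integrable fun x => p x + ‖x‖ ^ 2 * p x := hp.integrable.add hp.secondMoment
  -- One factor `2` comes from the two labels, the other from `(1 + ‖x‖) ^ 2 ≤ 2 * (1 + ‖x‖ ^ 2)`.
  -- Only the margin `δ` of `θ` enters, so the bound holds for all `θ'`.
  set K : ℝ := 4 * C ^ 2 / δ with hK
  have hK0 : 0 ≤ K := by positivity
  have hI0 : 0 ≤ ∫ x, (p x + ‖x‖ ^ 2 * p x) := integral_nonneg fun x => by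
    have := hp.nonneg x
    simp only [Pi.zero_apply]
    positivity
  refine ⟨K * (∫ x, (p x + ‖x‖ ^ 2 * p x)) + 1, by positivity, fun θ' => ?_⟩
  obtain ⟨hint, heq⟩ := hellingerSq_eq_integral hp θ θ'
  rw [heq]
  have hle : ∫ x, ((√(p x * output θ.1 x) - √(p x * output θ'.1 x)) ^ 2 +
        (√(p x * (1 - output θ.1 x)) - √(p x * (1 - output θ'.1 x))) ^ 2) ≤
      ∫ x, (K * ‖θ.1 - θ'.1‖ ^ 2) * (p x + ‖x‖ ^ 2 * p x) := by
    refine integral_mono_ae hint (hmom.const_mul _) ?_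
    filter_upwards [hadm, θ'.ae_pos] with x hx hx'
    rcases (hp.nonneg x).eq_or_lt with h0 | h0
    · simp [← h0]
    obtain ⟨e1, e2⟩ := hx h0
    obtain ⟨e3, e4⟩ := hx' h0
    set f := output θ.1 x
    set f' := output θ'.1 x
    have hlip : (f - f') ^ 2 ≤ (C * (1 + ‖x‖) * ‖θ.1 - θ'.1‖) ^ 2 :=
      sq_le_sq' (neg_le_of_abs_le (abs_output_sub_le _ _ _)) (le_of_abs_le (abs_output_sub_le _ _ _))
    have hsq : (1 + ‖x‖) ^ 2 ≤ 2 * (1 + ‖x‖ ^ 2) := by nlinarith [sq_nonneg (1 - ‖x‖)]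
    have hstep : ∀ a b : ℝ, δ ≤ a → 0 ≤ b → (a - b) ^ 2 = (f - f') ^ 2 →
        (√(p x * a) - √(p x * b)) ^ 2 ≤ p x * (f - f') ^ 2 / δ := by
      intro a b ha hb hab
      have ha0 : 0 < a := hδ.trans_le ha
      refine (sq_sqrt_sub_sqrt_le (mul_pos h0 ha0) (mul_nonneg h0.le hb)).trans ?_
      rw [← mul_sub, mul_pow, hab, show p x ^ 2 * (f - f') ^ 2 / (p x * a) =
        p x * (f - f') ^ 2 / a by field_simp]
      gcongr
    have s1 := hstep f f' e1 e3.le rfl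
    have s2 := hstep (1 - f) (1 - f') (by linarith) (by linarith) (by ring)
    calc _ ≤ p x * (f - f') ^ 2 / δ + p x * (f - f') ^ 2 / δ := add_le_add s1 s2
      _ = 2 * p x / δ * (f - f') ^ 2 := by ring
      _ ≤ 2 * p x / δ * (C * (1 + ‖x‖) * ‖θ.1 - θ'.1‖) ^ 2 := by gcongr
      _ = 2 * p x / δ * (C ^ 2 * ‖θ.1 - θ'.1‖ ^ 2) * (1 + ‖x‖) ^ 2 := by ring
      _ ≤ 2 * p x / δ * (C ^ 2 * ‖θ.1 - θ'.1‖ ^ 2) * (2 * (1 + ‖x‖ ^ 2)) := by gcongr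
      _ = _ := by rw [hK]; ring
  refine hle.trans ?_
  rw [integral_const_mul]
  nlinarith [sq_nonneg ‖θ.1 - θ'.1‖]

lemma integrable_mul_sq (hp : IsInputDensity p) (θ θ' : Network p k) :
    Integrable fun x => p x * (output θ'.1 x - output θ.1 x) ^ 2 := by
  refine hp.integrable.mono' ?_ ?_
  · exact (hp.measurable.mul
      (((measurable_output θ'.1).sub (measurable_output θ.1)).pow_const 2)).aestronglyMeasurable
  · filter_upwards [θ.ae_pos, θ'.ae_pos] with x hx hx'
    rcases (hp.nonneg x).eq_or_lt with h0 | h0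
    · simp [← h0]
    obtain ⟨e1, e2⟩ := hx h0
    obtain ⟨e3, e4⟩ := hx' h0
    rw [Real.norm_eq_abs, abs_of_nonneg (mul_nonneg h0.le (sq_nonneg _))]
    have : (output θ'.1 x - output θ.1 x) ^ 2 ≤ 1 := by nlinarith
    nlinarith

lemma integral_mul_sq_le (hp : IsInputDensity p) (θ θ' : Network p k) :
    ∫ x, p x * (output θ'.1 x - output θ.1 x) ^ 2 ≤
      4 * hellingerSq (toFactor θ) (toFactor θ') := by
  obtain ⟨hint, heq⟩ := hellingerSq_eq_integral hp θ θ'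
  rw [heq, ← integral_const_mul]
  refine integral_mono_ae (integrable_mul_sq hp θ θ') (hint.const_mul 4) ?_
  filter_upwards [θ.ae_pos, θ'.ae_pos] with x hx hx'
  rcases (hp.nonneg x).eq_or_lt with h0 | h0
  · simp [← h0]
  obtain ⟨e1, e2⟩ := hx h0
  obtain ⟨e3, e4⟩ := hx' h0
  have h1 := mul_sq_sub_le h0.le e1.le e2.le e3.le e4.le
  have h2 : (output θ'.1 x - output θ.1 x) ^ 2 = (output θ.1 x - output θ'.1 x) ^ 2 := by ring
  rw [h2]
  have h3 := sq_nonneg (√(p x * (1 - output θ.1 x)) - √(p x * (1 - output θ'.1 x)))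
  linarith

/-- A sequence of networks that converges to `θ` in Hellinger distance faster than in weight
distance does not exist. -/
lemma not_hellinger_faster (hp : IsInputDensity p) (θ : Network p k) (q : ℕ → FactorSpace p k)
    (h1 : ∀ n : ℕ, hellingerDist (toFactor θ) (q n) ≤ 1 / ((n : ℝ) + 1))
    (h2 : ∀ n : ℕ, hellingerDist (toFactor θ) (q n) < 1 / ((n : ℝ) + 1) * weightDist (toFactor θ) (q n)) :
    False := by
  choose θs hθs using fun n => exists_toFactor (q n)
  set D : ℕ → ℝ := fun n => weightDist (toFactor θ) (q n) with hD
  have hD0 : ∀ n, 0 < D n := by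
    intro n
    have h3 := (Real.sqrt_nonneg _).trans_lt (h2 n)
    exact pos_of_mul_pos_right h3 (by positivity)
  set g : ℕ → Input d → ℝ := fun n x => output (θs n).1 x - output θ.1 x with hg
  -- The weight combines `g n ^ 2` and `(g n / D n) ^ 2`, so one subsequence converging almost
  -- everywhere serves both.
  set Φ : ℕ → Input d → ℝ := fun n x => (1 + 1 / D n ^ 2) * (p x * g n x ^ 2) with hΦ
  have hΦint : ∀ n, Integrable (Φ n) := fun n => (integrable_mul_sq hp θ (θs n)).const_mul _
  have hΦ0 : ∀ n x, 0 ≤ Φ n x := fun n x => by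
    have := hp.nonneg x
    have := hD0 n
    simp only [hΦ]
    positivity
  have hΦb : ∀ n : ℕ, ∫ x, Φ n x ≤ 8 * (1 / ((n : ℝ) + 1)) ^ 2 := by
    intro n
    have h3 := integral_mul_sq_le hp θ (θs n)
    rw [hθs, ← hellingerDist_sq] at h3
    set ρ := hellingerDist (toFactor θ) (q n) with hρ
    have hρ0 : 0 ≤ ρ := Real.sqrt_nonneg _
    have h4 : ρ ^ 2 ≤ (1 / ((n : ℝ) + 1)) ^ 2 := by gcongr; exact h1 n
    have h5 : ρ ^ 2 ≤ (1 / ((n : ℝ) + 1)) ^ 2 * D n ^ 2 := by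
      rw [← mul_pow]; gcongr; exact (h2 n).le
    have h6 : ρ ^ 2 / D n ^ 2 ≤ (1 / ((n : ℝ) + 1)) ^ 2 := by
      rwa [div_le_iff₀ (by have := hD0 n; positivity)]
    rw [hΦ, integral_const_mul]
    calc _ ≤ (1 + 1 / D n ^ 2) * (4 * ρ ^ 2) := by
          refine mul_le_mul_of_nonneg_left h3 ?_
          positivity
      _ = 4 * ρ ^ 2 + 4 * (ρ ^ 2 / D n ^ 2) := by ring
      _ ≤ _ := by linarith
  have hmeas : TendstoInMeasure volume Φ atTop (0 : Input d → ℝ) := by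
    refine tendstoInMeasure_of_tendsto_eLpNorm one_ne_zero
      (fun n => (hΦint n).aestronglyMeasurable) aestronglyMeasurable_zero ?_
    have h3 : ∀ n, eLpNorm (Φ n - 0) 1 volume = ENNReal.ofReal (∫ x, Φ n x) := by
      intro n
      rw [sub_zero, eLpNorm_one_eq_lintegral_enorm, ofReal_integral_eq_lintegral_ofReal (hΦint n)
        (Eventually.of_forall (hΦ0 n))]
      refine lintegral_congr fun x => ?_
      rw [Real.enorm_eq_ofReal (hΦ0 n x)]
    simp only [h3]
    rw [← ENNReal.ofReal_zero]
    refine ENNReal.tendsto_ofReal ?_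
    refine squeeze_zero (fun n => integral_nonneg (hΦ0 n)) hΦb ?_
    have := (tendsto_one_div_add_atTop_nhds_zero_nat (𝕜 := ℝ)).pow 2
    simpa using this.const_mul 8
  obtain ⟨ns, hns, hae⟩ := hmeas.exists_seq_tendsto_ae
  have hP : ∀ᵐ x : Input d, 0 < p x → Tendsto (fun i => g (ns i) x) atTop (𝓝 0) ∧
      Tendsto (fun i => g (ns i) x / D (ns i)) atTop (𝓝 0) := by
    filter_upwards [hae] with x hx hpx
    have hx' : Tendsto (fun i => Φ (ns i) x / p x) atTop (𝓝 0) := by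
      simpa using hx.div_const (p x)
    have e : ∀ i, Φ (ns i) x / p x = g (ns i) x ^ 2 + (g (ns i) x / D (ns i)) ^ 2 := by
      intro i
      have := (hD0 (ns i)).ne'
      simp only [hΦ]
      field_simp
    simp only [e] at hx'
    have sq0 : ∀ u : ℕ → ℝ, Tendsto (fun i => u i ^ 2) atTop (𝓝 0) → Tendsto u atTop (𝓝 0) := by
      intro u hu
      rw [tendsto_zero_iff_abs_tendsto_zero]
      have := (Real.continuous_sqrt.tendsto 0).comp hu
      simp only [Real.sqrt_zero] at this
      exact this.congr fun i => Real.sqrt_sq_eq_abs _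
    exact ⟨sq0 _ (squeeze_zero (fun _ => sq_nonneg _) (fun i => le_add_of_nonneg_right (sq_nonneg _)) hx'),
      sq0 _ (squeeze_zero (fun _ => sq_nonneg _) (fun i => le_add_of_nonneg_left (sq_nonneg _)) hx')⟩
  obtain ⟨A, hA, hA0, hAP⟩ := hp.exists_set hP
  set 𝒰 : Ultrafilter ℕ := hyperfilter ℕ with h𝒰
  have h𝒰le : (𝒰 : Filter ℕ) ≤ atTop := Nat.hyperfilter_le_atTop
  have hconv : ∀ x ∈ A, Tendsto (fun i => output (θs (ns i)).1 x) 𝒰 (𝓝 (output θ.1 x)) := by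
    intro x hx
    have := ((hAP x hx).2.1.mono_left h𝒰le).add_const (output θ.1 x)
    rw [zero_add] at this
    exact this.congr fun i => by simp [hg]
  obtain ⟨θ', hθ'⟩ := exists_tendsto_of_output_tendsto 𝒰 (fun i => (θs (ns i)).1) θ.2.1 hA hA0 hconv
  have houteq : ∀ x ∈ A, output θ' x = output θ.1 x := fun x hx =>
    tendsto_nhds_unique (((continuous_output x).tendsto θ').comp hθ') (hconv x hx)
  obtain ⟨σ, s, rfl⟩ := eq_relabel_of_output_eq θ.2.1 hA hA0 houteq
  -- The distance to this particular representative is at least `D`, so division by `r` preserves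
  -- the limit zero of `g / D`.
  set r : ℕ → ℝ := fun i => ‖(θs (ns i)).1 - relabel σ s θ.1‖ with hr
  have hrD : ∀ i, D (ns i) ≤ r i := by
    intro i
    have := weightDist_le (θ.relabel σ s) (θs (ns i))
    rw [toFactor_relabel, hθs, norm_sub_rev] at this
    exact this
  have hr0 : ∀ i, 0 < r i := fun i => (hD0 _).trans_le (hrD i)
  set η : ℕ → Weights k d := fun i => (r i)⁻¹ • ((θs (ns i)).1 - relabel σ s θ.1) with hη
  have hηnorm : ∀ i, ‖η i‖ = 1 := by
    intro i
    rw [hη]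
    simp only [norm_smul, norm_inv, Real.norm_eq_abs, abs_of_pos (hr0 i)]
    exact inv_mul_cancel₀ (hr0 i).ne'
  obtain ⟨l, hl⟩ := tendsto_of_bounded 𝒰 (x := η) (a := 0) (C := 1)
    (Eventually.of_forall fun i => by rw [dist_zero_right, hηnorm])
  have hlnorm : ‖l‖ = 1 :=
    tendsto_nhds_unique hl.norm (by simp only [hηnorm]; exact tendsto_const_nhds)
  have hl0 : l = 0 := by
    refine eq_zero_of_outputDeriv_eq_zero (θ.2.1.relabel σ s) hA hA0 fun x hx => ?_
    obtain ⟨L, hL, hLv⟩ := exists_hasFDerivAt_output (relabel σ s θ.1) x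
    rw [← hLv]
    -- The increment of the output divided by `r` tends to zero and differs from `L` at the unit
    -- vector `η i` by a vanishing remainder; hence `L l = 0`.
    have ho := (hL.isLittleO.comp_tendsto hθ').norm_right.tendsto_div_nhds_zero
    have hq : Tendsto (fun i => g (ns i) x / r i) 𝒰 (𝓝 0) := by
      refine squeeze_zero_norm (fun i => ?_)
        (by simpa using ((hAP x hx).2.2.mono_left h𝒰le).abs)
      rw [Real.norm_eq_abs, abs_div, abs_div, abs_of_pos (hr0 i), abs_of_pos (hD0 _)]
      have := hD0 (ns i)
      have := hrD i
      gcongr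
    have h3 := hq.sub ho
    rw [sub_zero] at h3
    refine tendsto_nhds_unique ((L.continuous.tendsto l).comp hl) (h3.congr fun i => ?_)
    simp only [Function.comp, hg, hη, map_smul, smul_eq_mul, output_relabel]
    change _ / r i - _ / r i = _
    ring
  rw [hl0, norm_zero] at hlnorm
  exact zero_ne_one hlnorm

lemma locallyDominatedBy_weightDist (hp : IsInputDensity p) :
    LocallyDominatedBy (hellingerDist (k := k) (p := p)) (weightDist (k := k) (p := p)) := by
  intro q
  obtain ⟨θ, rfl⟩ := exists_toFactor q
  obtain ⟨M, hM, hMb⟩ := exists_hellingerSq_le hp θ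
  -- The same `1 / (n + 1)` serves as radius and as lower constant, so that failure for every `n`
  -- yields exactly the sequence already excluded.
  obtain ⟨n, hn⟩ : ∃ n : ℕ, ∀ q', hellingerDist (toFactor θ) q' ≤ 1 / ((n : ℝ) + 1) →
      1 / ((n : ℝ) + 1) * weightDist (toFactor θ) q' ≤ hellingerDist (toFactor θ) q' := by
    by_contra! hcon
    choose q h1 h2 using hcon
    exact not_hellinger_faster hp θ q h1 h2
  refine ⟨1 / ((n : ℝ) + 1), by positivity, 1 / ((n : ℝ) + 1), by positivity, √M,
    Real.sqrt_pos.2 hM, fun q' hq' => ⟨hn q' hq', ?_⟩⟩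
  obtain ⟨θ', rfl, h⟩ := exists_weightDist_eq θ q'
  rw [h, hellingerDist, ← Real.sqrt_sq (norm_nonneg (θ.1 - θ'.1)), ← Real.sqrt_mul hM.le]
  exact Real.sqrt_le_sqrt (hMb θ')

end LDR

theorem theorem6 (k d : ℕ) (p : LDR.Input d → ℝ) (hp : LDR.IsInputDensity p) :
    LDR.IsMetric (LDR.hellingerDist (k := k) (p := p)) ∧
    LDR.IsMetric (LDR.weightDist (k := k) (p := p)) ∧
    LDR.LocallyDominatedBy (LDR.hellingerDist (k := k) (p := p))
      (LDR.weightDist (k := k) (p := p)) :=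
  ⟨LDR.isMetric_hellingerDist hp, LDR.isMetric_weightDist, LDR.locallyDominatedBy_weightDist hp⟩
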